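/- Let $0<l<L$. Let $\mathcal A_{l,L}$ be the set of curves $\gamma\in C^\infty([0,1];\mathbb R^2)$ with $\gamma(0)=(0,0)$, $\gamma(1)=(l,0)$, length $\int_0^1|\gamma'|\,dt=L$, and $\gamma'(t)\neq 0$ for all $t\in[0,1]$. For $\gamma\in\mathcal A_{l,L}$ let $\tilde\gamma:[0,L]\to\mathbb R^2$ be its arc-length reparametrization and $\mathcal W(\gamma)=\int_\gamma\kappa^2\,ds$ its elastic energy, where $\kappa$ is the curvature. A curve $\gamma\in\mathcal A_{l,L}$ is called a critical point of $\mathcal W$ in $\mathcal A_{l,L}$ if $\frac{d}{d\varepsilon}\mathcal W(\gamma_\varepsilon)\big|_{\varepsilon=0}=0$ for every family $(\gamma_\varepsilon)_{|\varepsilon|<\varepsilon_0}$ of curves in $\mathcal A_{l,L}$ that is smooth in $(\varepsilon,t)\in(-\varepsilon_0,\varepsilon_0)\times[0,1]$ and satisfies $\gamma_0=\gamma$. For $0<p<1$ let $$\mathrm K(p)=\int_0^1\frac{dz}{\sqrt{1-z^2}\sqrt{1-p^2z^2}},\qquad \mathrm E(p)=\int_0^1\frac{\sqrt{1-p^2z^2}}{\sqrt{1-z^2}}\,dz,$$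 and let $\mathrm{cn}(x,p)=\cos\phi$, where $\phi\in\mathbb R$ is determined by $x=\int_0^\phi\frac{d\theta}{\sqrt{1-p^2\sin^2\theta}}$. **Theorem 1.1.** There is exactly one $\hat p\in(0,1)$ with $2\,\mathrm E(\hat p)/\mathrm K(\hat p)-1=l/L$, and exactly one $\check p\in(0,1)$ with $-2\,\mathrm E(\check p)/\mathrm K(\check p)+1=l/L$. The set of critical points of $\mathcal W$ in $\mathcal A_{l,L}$ is $$\{\gamma\in\mathcal A_{l,L} : \tilde\gamma\in\{\hat\gamma_n^+,\hat\gamma_n^-,\check\gamma_n^+,\check\gamma_n^-\}\text{ for some integer } n\ge 0\},$$ where, for $s\in[0,L]$, $\hat\gamma_n^\pm(s)=(\hat X_n(s),\pm\hat Y_n(s))$ with $$\hat X_n(s)=2\hat p^2\int_0^s\mathrm{cn}\Big(\tfrac{2(n+1)\mathrm K(\hat p)}{L}t+\mathrm K(\hat p),\hat p\Big)^2dt+(1-2\hat p^2)s,\qquad \hat Y_n(s)=-\frac{\hat pL}{(n+1)\mathrm K(\hat p)}\,\mathrm{cn}\Big(\tfrac{2(n+1)\mathrm K(\hat p)}{L}s+\mathrm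 K(\hat p),\hat p\Big),$$ and $\check\gamma_n^\pm(s)=(\check X_n(s),\pm\check Y_n(s))$ with $$\check X_n(s)=-2\check p^2\int_0^s\mathrm{cn}\Big(\tfrac{2(n+1)\mathrm K(\check p)}{L}t-\mathrm K(\check p),\check p\Big)^2dt-(1-2\check p^2)s,\qquad \check Y_n(s)=\frac{\check pL}{(n+1)\mathrm K(\check p)}\,\mathrm{cn}\Big(\tfrac{2(n+1)\mathrm K(\check p)}{L}s-\mathrm K(\check p),\check p\Big).$$ -/

import Mathlib

open Set MeasureTheory
open scoped ContDiff

noncomputable section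

namespace PinnedElastica

/-- The Euclidean plane. -/
abbrev Plane : Type := EuclideanSpace ℝ (Fin 2)

/-! ### Curves, length, curvature, elastic energy

A curve is a function `γ : ℝ → Plane` of which only the values on `[0,1]` matter: derivatives are
taken within `[0,1]`, so they are one-sided at the end points. -/

/-- First derivative of a curve on `[0,1]`. -/
def vel (γ : ℝ → Plane) (t : ℝ) : Plane := derivWithin γ (Icc 0 1) t

/-- Second derivative of a curve on `[0,1]`. -/
def acc (γ : ℝ → Plane) (t : ℝ) : Plane := derivWithin (vel γ) (Icc 0 1) t

/-- Arc length of `γ` from parameter `0` to parameter `t`. -/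
def arcLength (γ : ℝ → Plane) (t : ℝ) : ℝ := ∫ u in (0 : ℝ)..t, ‖vel γ u‖

/-- The length of a curve. -/
def length (γ : ℝ → Plane) : ℝ := arcLength γ 1

/-- Signed curvature `(x' y'' - y' x'') / |γ'|^3`. -/
def curvature (γ : ℝ → Plane) (t : ℝ) : ℝ :=
  (vel γ t 0 * acc γ t 1 - vel γ t 1 * acc γ t 0) / ‖vel γ t‖ ^ 3

/-- The elastic energy `∫_γ κ² ds`, where `ds = |γ'(t)| dt`. -/
def elasticEnergy (γ : ℝ → Plane) : ℝ :=
  ∫ t in (0 : ℝ)..1, curvature γ t ^ 2 * ‖vel γ t‖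

/-- The arc length reparametrization `γ ∘ s⁻¹ : [0, length γ] → Plane`, where `s` is the arc length
function `[0,1] → [0, length γ]` (a bijection when `γ` is regular). -/
def arcLengthReparam (γ : ℝ → Plane) (s : ℝ) : Plane :=
  γ (Function.invFunOn (arcLength γ) (Icc 0 1) s)

/-- Smooth regular curves of length `L` from `(0,0)` to `(l,0)`. -/
structure IsAdmissible (l L : ℝ) (γ : ℝ → Plane) : Prop where
  smooth : ContDiffOn ℝ ∞ γ (Icc 0 1)
  start : γ 0 = !₂[0, 0]
  finish : γ 1 = !₂[l, 0]
  length_eq : length γ = L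
  regular : ∀ t ∈ Icc (0 : ℝ) 1, vel γ t ≠ 0

/-- A smooth one-parameter family `(Γ ε)`, `|ε| < ε₀`, of admissible curves with `Γ 0 = γ`. -/
structure IsVariation (l L : ℝ) (γ : ℝ → Plane) (ε₀ : ℝ) (Γ : ℝ → ℝ → Plane) : Prop where
  pos : 0 < ε₀
  smooth : ContDiffOn ℝ ∞ (Function.uncurry Γ) (Ioo (-ε₀) ε₀ ×ˢ Icc 0 1)
  admissible : ∀ ε ∈ Ioo (-ε₀) ε₀, IsAdmissible l L (Γ ε)
  base : EqOn (Γ 0) γ (Icc 0 1)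

/-- `γ` is a critical point of the elastic energy among admissible curves: the energy is stationary
at `ε = 0` along every smooth variation of `γ` through admissible curves. -/
def IsCriticalPoint (l L : ℝ) (γ : ℝ → Plane) : Prop :=
  IsAdmissible l L γ ∧
    ∀ (ε₀ : ℝ) (Γ : ℝ → ℝ → Plane), IsVariation l L γ ε₀ Γ →
      HasDerivAt (fun ε => elasticEnergy (Γ ε)) 0 0

/-! ### Elliptic integrals and Jacobi's function cn, in terms of the modulus `p` -/

/-- Complete elliptic integral of the first kind. -/
def ellipticK (p : ℝ) : ℝ :=
  ∫ z in (0 : ℝ)..1, 1 / (√(1 - z ^ 2) * √(1 - p ^ 2 * z ^ 2))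

/-- Complete elliptic integral of the second kind. -/
def ellipticE (p : ℝ) : ℝ :=
  ∫ z in (0 : ℝ)..1, √(1 - p ^ 2 * z ^ 2) / √(1 - z ^ 2)

/-- Incomplete elliptic integral of the first kind. -/
def ellipticF (p φ : ℝ) : ℝ :=
  ∫ θ in (0 : ℝ)..φ, 1 / √(1 - p ^ 2 * Real.sin θ ^ 2)

/-- The amplitude `am(x, p)`: the inverse of `φ ↦ ellipticF p φ`, a bijection of `ℝ` if
`0 ≤ p < 1`. -/
def jacobiAm (x p : ℝ) : ℝ := Function.invFun (ellipticF p) x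

/-- Jacobi's elliptic function `cn(x, p)`. -/
def jacobiCn (x p : ℝ) : ℝ := Real.cos (jacobiAm x p)

/-! ### The explicit curves; `σ = 1` and `σ = -1` give the superscripts `+` and `-` -/

def hatX (L p : ℝ) (n : ℕ) (s : ℝ) : ℝ :=
  2 * p ^ 2 *
      (∫ t in (0 : ℝ)..s, jacobiCn (2 * (n + 1) * ellipticK p / L * t + ellipticK p) p ^ 2) +
    (1 - 2 * p ^ 2) * s

def hatY (L p : ℝ) (n : ℕ) (s : ℝ) : ℝ :=
  -(p * L / ((n + 1) * ellipticK p)) *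
    jacobiCn (2 * (n + 1) * ellipticK p / L * s + ellipticK p) p

def hatCurve (L p : ℝ) (n : ℕ) (σ : ℝ) (s : ℝ) : Plane :=
  !₂[hatX L p n s, σ * hatY L p n s]

def checkX (L p : ℝ) (n : ℕ) (s : ℝ) : ℝ :=
  -(2 * p ^ 2) *
      (∫ t in (0 : ℝ)..s, jacobiCn (2 * (n + 1) * ellipticK p / L * t - ellipticK p) p ^ 2) -
    (1 - 2 * p ^ 2) * s

def checkY (L p : ℝ) (n : ℕ) (s : ℝ) : ℝ :=
  p * L / ((n + 1) * ellipticK p) *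
    jacobiCn (2 * (n + 1) * ellipticK p / L * s - ellipticK p) p

def checkCurve (L p : ℝ) (n : ℕ) (σ : ℝ) (s : ℝ) : Plane :=
  !₂[checkX L p n s, σ * checkY L p n s]

/-- `p` is a modulus in `(0,1)` with `2 E(p) / K(p) - 1 = l / L`. -/
def IsHatModulus (l L p : ℝ) : Prop :=
  p ∈ Ioo (0 : ℝ) 1 ∧ 2 * (ellipticE p / ellipticK p) - 1 = l / L

/-- `p` is a modulus in `(0,1)` with `-2 E(p) / K(p) + 1 = l / L`. -/
def IsCheckModulus (l L p : ℝ) : Prop :=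
  p ∈ Ioo (0 : ℝ) 1 ∧ -2 * (ellipticE p / ellipticK p) + 1 = l / L

end PinnedElastica

end

/-! The critical curves are exactly the admissible curves satisfying `κ = -lam * y` for some
constant `lam`, and this equation can be solved explicitly.

The first variation of the energy is the integral of `2 κ Θ' - κ² δ|γ'|`, where `Θ` is the variation
of the tangent angle (`IsVariation.first_variation`). If `κ = -lam * y`, then `κ²` is an affine
function of the horizontal component of the unit tangent. The integrand becomes a total derivative
minus a multiple of the variation of length, and all boundary terms vanish
(`isCriticalPoint_of_curvature_eq`).

The converse needs enough variations inside the constrained class. Multiplying `γ'` by `(1 + i(ε φ +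
s ψ))²` bends the curve, and a similarity brings the end point back to `(l, 0)`. One scalar
equation, for the length, remains. The implicit function theorem solves it for `s`, with `ψ = y'` as
the correcting direction; this is nondegenerate because `l < L` prevents a horizontal curve
(`exists_variation`). Taking `φ' = κ + lam * y`, with `lam` chosen to cancel the effect of the
correction, makes stationarity say that the square of `κ + lam * y` has integral zero
(`exists_curvature_eq`).

Write `lam = τ ν²` with `τ = ±1`. Height and unit tangent then solve a first order system which the
explicit elastica of frequency `ν` solves too. Uniqueness identifies the two, up to reflections,
once the modulus matches the initial slope (`exists_eq_profile`). The end condition `y = 0` forces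
`ν L = 2(n+1)K`, and `x = l` becomes `τ(2E/K - 1) = l/L` (`exists_frequency_eq`): `τ = 1` gives the
hat curves and `τ = -1` the check curves. Each modulus exists and is unique because `E/K` decreases
strictly and continuously on `(0,1)`, from `1` at `p = 0` to values arbitrarily near `0`. -/

namespace PinnedElastica

/-! ### The Jacobi amplitude -/

theorem one_sub_mul_sin_sq_pos {p : ℝ} (hp : p ^ 2 < 1) (θ : ℝ) :
    0 < 1 - p ^ 2 * Real.sin θ ^ 2 := by
  nlinarith [Real.sin_sq_le_one θ, sq_nonneg (Real.sin θ), sq_nonneg p]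

theorem continuous_delta (p : ℝ) : Continuous fun θ => √(1 - p ^ 2 * Real.sin θ ^ 2) := by
  fun_prop

theorem delta_pos {p : ℝ} (hp : p ^ 2 < 1) (θ : ℝ) : 0 < √(1 - p ^ 2 * Real.sin θ ^ 2) :=
  Real.sqrt_pos.2 (one_sub_mul_sin_sq_pos hp θ)

theorem delta_le_one (p θ : ℝ) : √(1 - p ^ 2 * Real.sin θ ^ 2) ≤ 1 := by
  rw [Real.sqrt_le_one]
  nlinarith [mul_nonneg (sq_nonneg p) (sq_nonneg (Real.sin θ))]

theorem continuous_one_div_delta {p : ℝ} (hp : p ^ 2 < 1) :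
    Continuous fun θ => 1 / √(1 - p ^ 2 * Real.sin θ ^ 2) :=
  continuous_const.div (continuous_delta p) fun θ => (delta_pos hp θ).ne'

theorem hasDerivAt_ellipticF {p : ℝ} (hp : p ^ 2 < 1) (φ : ℝ) :
    HasDerivAt (ellipticF p) (1 / √(1 - p ^ 2 * Real.sin φ ^ 2)) φ :=
  (continuous_one_div_delta hp).integral_hasStrictDerivAt 0 φ |>.hasDerivAt

theorem ellipticF_zero (p : ℝ) : ellipticF p 0 = 0 := by simp [ellipticF]

/-- The integrand is at least `1`. This gives both strict monotonicity and unboundedness in both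
directions, so `invFun` in `jacobiAm` is a genuine inverse. -/
theorem monotone_ellipticF_sub_id {p : ℝ} (hp : p ^ 2 < 1) :
    Monotone fun φ => ellipticF p φ - φ := by
  refine monotone_of_hasDerivAt_nonneg
    (f' := fun φ => 1 / √(1 - p ^ 2 * Real.sin φ ^ 2) - 1)
    (fun φ => (hasDerivAt_ellipticF hp φ).sub (hasDerivAt_id φ)) fun φ => ?_
  have := (one_le_div (delta_pos hp φ)).2 (delta_le_one p φ)
  simpa using this

theorem strictMono_ellipticF {p : ℝ} (hp : p ^ 2 < 1) : StrictMono (ellipticF p) := by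
  intro a b hab
  have := monotone_ellipticF_sub_id hp hab.le
  simp only at this
  linarith

theorem continuous_ellipticF {p : ℝ} (hp : p ^ 2 < 1) : Continuous (ellipticF p) :=
  continuous_iff_continuousAt.2 fun φ => (hasDerivAt_ellipticF hp φ).continuousAt

theorem surjective_ellipticF {p : ℝ} (hp : p ^ 2 < 1) : Function.Surjective (ellipticF p) := by
  refine (continuous_ellipticF hp).surjective ?_ ?_
  · refine Filter.tendsto_atTop_mono' _ ?_ Filter.tendsto_id
    filter_upwards [Filter.eventually_ge_atTop 0] with φ hφ
    have := monotone_ellipticF_sub_id hp hφ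
    simp only [ellipticF_zero] at this
    simp only [id]; linarith
  · refine Filter.tendsto_atBot_mono' _ ?_ Filter.tendsto_id
    filter_upwards [Filter.eventually_le_atBot 0] with φ hφ
    have := monotone_ellipticF_sub_id hp hφ
    simp only [ellipticF_zero] at this
    simp only [id]; linarith

theorem ellipticF_jacobiAm {p : ℝ} (hp : p ^ 2 < 1) (x : ℝ) : ellipticF p (jacobiAm x p) = x :=
  Function.invFun_eq (surjective_ellipticF hp x)

theorem jacobiAm_ellipticF {p : ℝ} (hp : p ^ 2 < 1) (φ : ℝ) : jacobiAm (ellipticF p φ) p = φ :=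
  Function.leftInverse_invFun (strictMono_ellipticF hp).injective φ

theorem strictMono_jacobiAm {p : ℝ} (hp : p ^ 2 < 1) : StrictMono fun x => jacobiAm x p := by
  intro a b hab
  rw [← (strictMono_ellipticF hp).lt_iff_lt]
  simpa only [ellipticF_jacobiAm hp] using hab

theorem continuous_jacobiAm {p : ℝ} (hp : p ^ 2 < 1) : Continuous fun x => jacobiAm x p :=
  (strictMono_jacobiAm hp).monotone.continuous_of_surjective
    fun φ => ⟨ellipticF p φ, jacobiAm_ellipticF hp φ⟩

theorem hasDerivAt_jacobiAm {p : ℝ} (hp : p ^ 2 < 1) (x : ℝ) :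
    HasDerivAt (fun x => jacobiAm x p) √(1 - p ^ 2 * Real.sin (jacobiAm x p) ^ 2) x := by
  have h := HasDerivAt.of_local_left_inverse (continuous_jacobiAm hp).continuousAt
    (hasDerivAt_ellipticF hp (jacobiAm x p))
    (one_div_ne_zero (delta_pos hp _).ne') (.of_forall (ellipticF_jacobiAm hp))
  simpa using h

/-! ### Complete integrals in trigonometric form -/

theorem image_sin_Ioo : Real.sin '' Ioo 0 (Real.pi / 2) = Ioo 0 1 := by
  ext y
  constructor
  · rintro ⟨θ, hθ, rfl⟩
    refine ⟨Real.sin_pos_of_pos_of_lt_pi hθ.1 (by linarith [hθ.2, Real.pi_pos]), ?_⟩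
    rw [← Real.sin_pi_div_two]
    exact Real.strictMonoOn_sin ⟨by linarith [hθ.1, Real.pi_pos], hθ.2.le⟩
      ⟨by linarith [Real.pi_pos], le_rfl⟩ hθ.2
  · intro hy
    exact ⟨Real.arcsin y, ⟨Real.arcsin_pos.2 hy.1, Real.arcsin_lt_pi_div_two.2 hy.2⟩,
      Real.sin_arcsin (by linarith [hy.1]) hy.2.le⟩

/-- Change of variables for an injective map needs no regularity of `g`. Passing to open intervals
discards `z = 1`, where the integrands of `K` and `E` have a vanishing denominator. -/
theorem integral_sin_substitution (g : ℝ → ℝ) :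
    ∫ z in (0 : ℝ)..1, g z =
      ∫ θ in (0 : ℝ)..(Real.pi / 2), Real.cos θ * g (Real.sin θ) := by
  have hpi := Real.pi_pos
  have hsub : Ioo 0 (Real.pi / 2) ⊆ Icc (-(Real.pi / 2)) (Real.pi / 2) :=
    fun θ hθ => ⟨by linarith [hθ.1], hθ.2.le⟩
  rw [intervalIntegral.integral_of_le zero_le_one, integral_Ioc_eq_integral_Ioo,
    intervalIntegral.integral_of_le (by linarith), integral_Ioc_eq_integral_Ioo,
    ← image_sin_Ioo, integral_image_eq_integral_abs_deriv_smul measurableSet_Ioo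
      (fun θ _ => (Real.hasDerivAt_sin θ).hasDerivWithinAt)
      (Real.strictMonoOn_sin.injOn.mono hsub)]
  refine setIntegral_congr_fun measurableSet_Ioo fun θ hθ => ?_
  simp only [smul_eq_mul]
  rw [abs_of_pos (Real.cos_pos_of_mem_Ioo ⟨by linarith [hθ.1], hθ.2⟩)]

theorem integral_congr_Ioo_zero_pi_div_two {f g : ℝ → ℝ}
    (h : ∀ θ ∈ Ioo 0 (Real.pi / 2), f θ = g θ) :
    ∫ θ in (0 : ℝ)..(Real.pi / 2), f θ = ∫ θ in (0 : ℝ)..(Real.pi / 2), g θ := by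
  have hpi := Real.pi_pos
  rw [intervalIntegral.integral_of_le (by linarith), integral_Ioc_eq_integral_Ioo,
    intervalIntegral.integral_of_le (by linarith), integral_Ioc_eq_integral_Ioo]
  exact setIntegral_congr_fun measurableSet_Ioo h

theorem ellipticK_eq (p : ℝ) : ellipticK p = ellipticF p (Real.pi / 2) := by
  rw [ellipticK, integral_sin_substitution, ellipticF]
  refine integral_congr_Ioo_zero_pi_div_two fun θ hθ => ?_
  have hc := Real.cos_pos_of_mem_Ioo ⟨by linarith [hθ.1, Real.pi_pos], hθ.2⟩
  rw [← Real.cos_sq', Real.sqrt_sq hc.le, mul_one_div, div_mul_eq_div_div, div_self hc.ne']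

/-- Incomplete elliptic integral of the second kind. -/
noncomputable def ellipticEInc (p φ : ℝ) : ℝ :=
  ∫ θ in (0 : ℝ)..φ, √(1 - p ^ 2 * Real.sin θ ^ 2)

theorem ellipticE_eq (p : ℝ) : ellipticE p = ellipticEInc p (Real.pi / 2) := by
  rw [ellipticE, integral_sin_substitution, ellipticEInc]
  refine integral_congr_Ioo_zero_pi_div_two fun θ hθ => ?_
  have hc := Real.cos_pos_of_mem_Ioo ⟨by linarith [hθ.1, Real.pi_pos], hθ.2⟩
  rw [← Real.cos_sq', Real.sqrt_sq hc.le, mul_div_cancel₀ _ hc.ne']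

theorem hasDerivAt_ellipticEInc (p φ : ℝ) :
    HasDerivAt (ellipticEInc p) √(1 - p ^ 2 * Real.sin φ ^ 2) φ :=
  (continuous_delta p).integral_hasStrictDerivAt 0 φ |>.hasDerivAt

/-! ### Quasi-periodicity -/

/-- By periodicity the extra piece is a full period, which the reflection `θ ↦ π - θ` splits into
two equal halves. -/
theorem integral_add_pi {g : ℝ → ℝ} (hg : Continuous g) (hper : Function.Periodic g Real.pi)
    (hsymm : ∀ θ, g (Real.pi - θ) = g θ) (φ : ℝ) :
    ∫ θ in (0 : ℝ)..(φ + Real.pi), g θ =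
      (∫ θ in (0 : ℝ)..φ, g θ) + 2 * ∫ θ in (0 : ℝ)..(Real.pi / 2), g θ := by
  have hi : ∀ a b, IntervalIntegrable g volume a b := fun a b => hg.intervalIntegrable a b
  rw [← intervalIntegral.integral_add_adjacent_intervals (hi 0 φ) (hi φ _),
    hper.intervalIntegral_add_eq φ 0, zero_add,
    ← intervalIntegral.integral_add_adjacent_intervals (hi 0 (Real.pi / 2)) (hi _ Real.pi)]
  have : ∫ θ in (Real.pi / 2)..Real.pi, g θ = ∫ θ in (0 : ℝ)..(Real.pi / 2), g θ := by
    have h := intervalIntegral.integral_comp_sub_left (a := 0) (b := Real.pi / 2) g Real.pi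
    simp only [hsymm, sub_zero] at h
    rw [h]
    congr 1; ring
  rw [this]; ring

theorem ellipticF_add_pi {p : ℝ} (hp : p ^ 2 < 1) (φ : ℝ) :
    ellipticF p (φ + Real.pi) = ellipticF p φ + 2 * ellipticK p := by
  rw [ellipticK_eq]
  exact integral_add_pi (continuous_one_div_delta hp) (fun θ => by simp [Real.sin_add_pi])
    (fun θ => by simp [Real.sin_pi_sub]) φ

theorem ellipticEInc_add_pi (p φ : ℝ) :
    ellipticEInc p (φ + Real.pi) = ellipticEInc p φ + 2 * ellipticE p := by
  rw [ellipticE_eq]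
  exact integral_add_pi (continuous_delta p) (fun θ => by simp [Real.sin_add_pi])
    (fun θ => by simp [Real.sin_pi_sub]) φ

theorem ellipticK_pos {p : ℝ} (hp : p ^ 2 < 1) : 0 < ellipticK p := by
  rw [ellipticK_eq, ← ellipticF_zero p]
  exact strictMono_ellipticF hp (by positivity)

theorem jacobiAm_ellipticK {p : ℝ} (hp : p ^ 2 < 1) : jacobiAm (ellipticK p) p = Real.pi / 2 := by
  rw [ellipticK_eq, jacobiAm_ellipticF hp]

theorem jacobiAm_add_two_mul_ellipticK {p : ℝ} (hp : p ^ 2 < 1) (x : ℝ) :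
    jacobiAm (x + 2 * ellipticK p) p = jacobiAm x p + Real.pi := by
  apply (strictMono_ellipticF hp).injective
  rw [ellipticF_add_pi hp, ellipticF_jacobiAm hp, ellipticF_jacobiAm hp]

/-- A shift by `2K` flips the sign of `cn`. Hence the check formulas describe mirror images of the
hat formulas, and one profile serves both. -/
theorem jacobiCn_sub_ellipticK {p : ℝ} (hp : p ^ 2 < 1) (x : ℝ) :
    jacobiCn (x - ellipticK p) p = -jacobiCn (x + ellipticK p) p := by
  have : x + ellipticK p = x - ellipticK p + 2 * ellipticK p := by ring
  rw [this, jacobiCn, jacobiCn, jacobiAm_add_two_mul_ellipticK hp, Real.cos_add_pi, neg_neg]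

theorem ellipticF_pi_div_two_add {p : ℝ} (hp : p ^ 2 < 1) (m : ℕ) :
    ellipticF p (Real.pi / 2 + m * Real.pi) = (2 * m + 1) * ellipticK p := by
  induction m with
  | zero => simp [ellipticK_eq]
  | succ m ih =>
    have : Real.pi / 2 + ((m + 1 : ℕ) : ℝ) * Real.pi = Real.pi / 2 + m * Real.pi + Real.pi := by
      push_cast; ring
    rw [this, ellipticF_add_pi hp, ih]; push_cast; ring

theorem ellipticEInc_pi_div_two_add (p : ℝ) (m : ℕ) :
    ellipticEInc p (Real.pi / 2 + m * Real.pi) = (2 * m + 1) * ellipticE p := by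
  induction m with
  | zero => simp [ellipticE_eq]
  | succ m ih =>
    have : Real.pi / 2 + ((m + 1 : ℕ) : ℝ) * Real.pi = Real.pi / 2 + m * Real.pi + Real.pi := by
      push_cast; ring
    rw [this, ellipticEInc_add_pi, ih]; push_cast; ring

/-- The zeros of `cn(·, p)` to the right of `K(p)`. -/
theorem exists_eq_of_jacobiCn_eq_zero {p x : ℝ} (hp : p ^ 2 < 1) (hx : 0 < x)
    (h : jacobiCn (x + ellipticK p) p = 0) : ∃ n : ℕ, x = 2 * (n + 1) * ellipticK p ∧
      jacobiAm (x + ellipticK p) p = Real.pi / 2 + (n + 1 : ℕ) * Real.pi := by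
  obtain ⟨k, hk⟩ := Real.cos_eq_zero_iff.1 h
  have hlt : Real.pi / 2 < jacobiAm (x + ellipticK p) p := by
    rw [← jacobiAm_ellipticK hp]
    exact strictMono_jacobiAm hp (by linarith)
  -- The zero with `k = 0` is `x = 0` itself, so positive `x` starts at `k = 1`; hence the index `n
  -- + 1`.
  have hk0 : 0 < k := by
    rw [hk] at hlt
    have : (0 : ℝ) < k := by nlinarith [Real.pi_pos]
    exact_mod_cast this
  obtain ⟨n, rfl⟩ : ∃ n : ℕ, k = n + 1 := ⟨(k - 1).toNat, by omega⟩
  have ham : jacobiAm (x + ellipticK p) p = Real.pi / 2 + (n + 1 : ℕ) * Real.pi := by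
    rw [hk]; push_cast; ring
  refine ⟨n, ?_, ham⟩
  have := ellipticF_jacobiAm hp (x + ellipticK p)
  rw [ham, ellipticF_pi_div_two_add hp] at this
  push_cast at this
  linarith

/-! ### The moduli -/

theorem ellipticK_lt {p q : ℝ} (hp : 0 ≤ p) (hpq : p < q) (hq : q < 1) :
    ellipticK p < ellipticK q := by
  have hq1 : q ^ 2 < 1 := by nlinarith
  have hpq2 : p ^ 2 < q ^ 2 := by nlinarith
  have hpi := Real.pi_pos
  rw [ellipticK_eq, ellipticK_eq]
  refine intervalIntegral.integral_lt_integral_of_continuousOn_of_le_of_exists_lt (by linarith)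
    (continuous_one_div_delta (by linarith)).continuousOn
    (continuous_one_div_delta hq1).continuousOn (fun θ _ => ?_)
    ⟨Real.pi / 2, ⟨by linarith, le_rfl⟩, ?_⟩
  · exact one_div_le_one_div_of_le (delta_pos hq1 θ) (Real.sqrt_le_sqrt (by gcongr))
  · refine one_div_lt_one_div_of_lt (delta_pos hq1 _)
      (Real.sqrt_lt_sqrt (one_sub_mul_sin_sq_pos hq1 _).le ?_)
    simpa using hpq2

theorem ellipticE_lt {p q : ℝ} (hp : 0 ≤ p) (hpq : p < q) (hq : q < 1) :
    ellipticE q < ellipticE p := by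
  have hq1 : q ^ 2 < 1 := by nlinarith
  have hpq2 : p ^ 2 < q ^ 2 := by nlinarith
  have hpi := Real.pi_pos
  rw [ellipticE_eq, ellipticE_eq]
  refine intervalIntegral.integral_lt_integral_of_continuousOn_of_le_of_exists_lt (by linarith)
    (continuous_delta q).continuousOn (continuous_delta p).continuousOn (fun θ _ => ?_)
    ⟨Real.pi / 2, ⟨by linarith, le_rfl⟩, ?_⟩
  · exact Real.sqrt_le_sqrt (by gcongr)
  · refine Real.sqrt_lt_sqrt (one_sub_mul_sin_sq_pos hq1 _).le ?_
    simpa using hpq2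

theorem ellipticE_nonneg (p : ℝ) : 0 ≤ ellipticE p := by
  rw [ellipticE_eq]
  exact intervalIntegral.integral_nonneg (by positivity) fun _ _ => Real.sqrt_nonneg _

theorem ellipticE_le (p : ℝ) : ellipticE p ≤ Real.pi / 2 := by
  have := intervalIntegral.integral_mono_on (μ := volume) (a := 0) (b := Real.pi / 2) (by positivity)
    ((continuous_delta p).intervalIntegrable _ _)
    (continuous_const (y := (1 : ℝ)).intervalIntegrable _ _) fun θ _ => delta_le_one p θ
  rw [ellipticE_eq]
  simpa [ellipticEInc] using this

theorem ellipticE_div_ellipticK_strictAntiOn :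
    StrictAntiOn (fun p => ellipticE p / ellipticK p) (Ioo 0 1) := by
  intro p hp q hq hpq
  have h1 := ellipticE_lt hp.1.le hpq hq.2
  have h2 := ellipticK_lt hp.1.le hpq hq.2
  have h3 : 0 < ellipticK p := ellipticK_pos (by nlinarith [hp.1, hp.2])
  exact div_lt_div₀ h1 h2.le ((ellipticE_nonneg q).trans h1.le) h3

theorem continuous_ellipticE : Continuous ellipticE := by
  have : Continuous fun p : ℝ =>
      ∫ θ in (0 : ℝ)..(Real.pi / 2), √(1 - p ^ 2 * Real.sin θ ^ 2) :=
    intervalIntegral.continuous_parametric_intervalIntegral_of_continuous' (by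
      simp only [Function.uncurry_def]; fun_prop) _ _
  exact this.congr fun p => (ellipticE_eq p).symm

theorem continuousOn_ellipticK {r : ℝ} (hr0 : 0 ≤ r) (hr : r < 1) :
    ContinuousOn ellipticK (Icc 0 r) := by
  -- Clamping the modulus to `[0, r]` makes the integrand jointly continuous on the whole plane, as
  -- the theorem on parametric integrals requires.
  have hc : ∀ p, (max 0 (min p r)) ^ 2 < 1 := fun p => by
    have h1 : 0 ≤ max 0 (min p r) := le_max_left _ _
    have h2 : max 0 (min p r) ≤ r := max_le hr0 (min_le_right _ _)
    nlinarith
  have : Continuous fun p : ℝ =>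
      ∫ θ in (0 : ℝ)..(Real.pi / 2), 1 / √(1 - (max 0 (min p r)) ^ 2 * Real.sin θ ^ 2) := by
    refine intervalIntegral.continuous_parametric_intervalIntegral_of_continuous' ?_ _ _
    simp only [Function.uncurry_def]
    exact continuous_const.div (by fun_prop) fun x => (delta_pos (hc x.1) x.2).ne'
  refine this.continuousOn.congr fun p hp => ?_
  simp only [min_eq_left hp.2, max_eq_right hp.1, ellipticK_eq, ellipticF]

/-- With complementary modulus `k`, `1 - p² sin² φ = cos² φ + k² sin² φ ≤ (cos φ + k)² ≤ (π/2 - φ +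
k)²`. Integrating the reciprocal gives the logarithm, so `K` blows up as `k → 0`. -/
theorem log_le_ellipticK {p k : ℝ} (hp : p ^ 2 < 1) (hk : 0 < k) (hpk : p ^ 2 + k ^ 2 = 1) :
    Real.log (1 + Real.pi / (2 * k)) ≤ ellipticK p := by
  have hpi := Real.pi_pos
  have hmono : MonotoneOn (fun φ => ellipticF p φ + Real.log (Real.pi / 2 - φ + k))
      (Icc 0 (Real.pi / 2)) := by
    have hder : ∀ φ ∈ Icc 0 (Real.pi / 2),
        HasDerivAt (fun φ => ellipticF p φ + Real.log (Real.pi / 2 - φ + k))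
          (1 / √(1 - p ^ 2 * Real.sin φ ^ 2) + -1 / (Real.pi / 2 - φ + k)) φ := fun φ hφ =>
      (hasDerivAt_ellipticF hp φ).add
        ((((hasDerivAt_id φ).const_sub (Real.pi / 2)).add_const k).log
          (by simp only [id]; linarith [hφ.2]))
    refine monotoneOn_of_deriv_nonneg (convex_Icc _ _)
      (fun φ hφ => (hder φ hφ).continuousAt.continuousWithinAt)
      (fun φ hφ => (hder φ (interior_subset hφ)).differentiableAt.differentiableWithinAt)
      fun φ hφ => ?_
    replace hφ := interior_subset hφ
    rw [(hder φ hφ).deriv]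
    have hle : √(1 - p ^ 2 * Real.sin φ ^ 2) ≤ Real.pi / 2 - φ + k := by
      have hcos : Real.cos φ ≤ Real.pi / 2 - φ := by
        rw [← Real.sin_pi_div_two_sub]
        exact Real.sin_le (by linarith [hφ.2])
      have hcos0 : 0 ≤ Real.cos φ := Real.cos_nonneg_of_mem_Icc ⟨by linarith [hφ.1], hφ.2⟩
      refine Real.sqrt_le_iff.2 ⟨by linarith, ?_⟩
      have h1 := Real.sin_sq_add_cos_sq φ
      have h2 : (Real.cos φ + k) ^ 2 ≤ (Real.pi / 2 - φ + k) ^ 2 := by gcongr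
      have h3 : p ^ 2 = 1 - k ^ 2 := by linarith
      rw [h3]
      nlinarith [mul_nonneg hcos0 hk.le, sq_nonneg (k * Real.cos φ)]
    have := one_div_le_one_div_of_le (delta_pos hp φ) hle
    rw [neg_div]
    linarith
  have h := hmono (left_mem_Icc.2 (by linarith)) (right_mem_Icc.2 (by linarith)) (by linarith)
  simp only [ellipticF_zero, sub_zero, zero_add, sub_self, ← ellipticK_eq] at h
  have h1 : 1 + Real.pi / (2 * k) = (Real.pi / 2 + k) / k := by field_simp; ring
  rw [h1, Real.log_div (by positivity) hk.ne']
  linarith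

theorem exists_ellipticE_div_ellipticK_lt {c : ℝ} (hc : 0 < c) :
    ∃ r ∈ Ioo (0 : ℝ) 1, ellipticE r / ellipticK r < c := by
  have hpi := Real.pi_pos
  -- Since `E ≤ π/2`, it is enough that `K > M`. The choice of `k` makes the argument of the
  -- logarithm in `log_le_ellipticK` exceed `exp M`.
  set M := Real.pi / 2 / c
  have hM := Real.exp_pos M
  set k := 1 / (1 + Real.exp M)
  have hk0 : 0 < k := by positivity
  have hk1 : k < 1 := by rw [div_lt_one (by positivity)]; linarith
  have hr2 : √(1 - k ^ 2) ^ 2 = 1 - k ^ 2 := Real.sq_sqrt (by nlinarith)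
  have hr : √(1 - k ^ 2) ^ 2 < 1 := by rw [hr2]; nlinarith
  refine ⟨√(1 - k ^ 2), ⟨Real.sqrt_pos.2 (by nlinarith), ?_⟩, ?_⟩
  · nlinarith [Real.sqrt_nonneg (1 - k ^ 2)]
  · have hlog := log_le_ellipticK hr hk0 (by rw [hr2]; ring)
    have hMK : M < ellipticK √(1 - k ^ 2) := by
      refine lt_of_lt_of_le ?_ hlog
      rw [Real.lt_log_iff_exp_lt (by positivity)]
      have : Real.pi / (2 * k) = Real.pi / 2 * (1 + Real.exp M) := by
        simp only [k]; field_simp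
      rw [this]
      nlinarith [Real.pi_gt_three]
    rw [div_lt_iff₀ (ellipticK_pos hr)]
    have h1 : M * c = Real.pi / 2 := by simp only [M]; field_simp
    nlinarith [ellipticE_le √(1 - k ^ 2)]

/-- Intermediate values between `p = 0`, where the quotient is `1`, and a modulus where it is below
`c`. -/
theorem exists_ellipticE_div_ellipticK_eq {c : ℝ} (hc0 : 0 < c) (hc1 : c < 1) :
    ∃ p ∈ Ioo (0 : ℝ) 1, ellipticE p / ellipticK p = c := by
  obtain ⟨r, hr, hrc⟩ := exists_ellipticE_div_ellipticK_lt hc0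
  have h0 : ellipticE 0 / ellipticK 0 = 1 := by
    have : Real.pi ≠ 0 := Real.pi_ne_zero
    rw [ellipticE_eq, ellipticK_eq]
    simp [ellipticEInc, ellipticF, this]
  have hcont : ContinuousOn (fun p => ellipticE p / ellipticK p) (Icc 0 r) :=
    continuous_ellipticE.continuousOn.div (continuousOn_ellipticK hr.1.le hr.2)
      fun p hp => (ellipticK_pos (by nlinarith [hp.1, hp.2, hr.2])).ne'
  obtain ⟨p, hp, hpc⟩ := intermediate_value_Icc' hr.1.le hcont
    (show c ∈ Icc _ _ from ⟨hrc.le, by simpa only [h0] using hc1.le⟩)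
  simp only at hpc
  refine ⟨p, ⟨hp.1.lt_of_ne ?_, hp.2.trans_lt hr.2⟩, hpc⟩
  rintro rfl
  linarith

theorem existsUnique_isHatModulus {l L : ℝ} (hl : 0 < l) (hlL : l < L) :
    ∃! p : ℝ, IsHatModulus l L p := by
  have h0 : 0 < l / L := div_pos hl (hl.trans hlL)
  have h1 : l / L < 1 := (div_lt_one (hl.trans hlL)).2 hlL
  obtain ⟨p, hp, h⟩ := exists_ellipticE_div_ellipticK_eq (c := (1 + l / L) / 2)
    (by linarith) (by linarith)
  refine ⟨p, ⟨hp, by linarith⟩, fun q hq => ?_⟩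
  exact ellipticE_div_ellipticK_strictAntiOn.injOn hq.1 hp (by linarith [hq.2])

theorem existsUnique_isCheckModulus {l L : ℝ} (hl : 0 < l) (hlL : l < L) :
    ∃! p : ℝ, IsCheckModulus l L p := by
  have h0 : 0 < l / L := div_pos hl (hl.trans hlL)
  have h1 : l / L < 1 := (div_lt_one (hl.trans hlL)).2 hlL
  obtain ⟨p, hp, h⟩ := exists_ellipticE_div_ellipticK_eq (c := (1 - l / L) / 2)
    (by linarith) (by linarith)
  refine ⟨p, ⟨hp, by linarith⟩, fun q hq => ?_⟩
  exact ellipticE_div_ellipticK_strictAntiOn.injOn hq.1 hp (by linarith [hq.2])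

/-! ### Calculus on the unit interval -/

theorem uniqueDiffOn_unitInterval : UniqueDiffOn ℝ (Icc (0 : ℝ) 1) :=
  uniqueDiffOn_Icc zero_lt_one

theorem hasDerivWithinAt_of_smooth {E : Type*} [NormedAddCommGroup E] [NormedSpace ℝ E]
    {f : ℝ → E} (hf : ContDiffOn ℝ ∞ f (Icc 0 1)) {t : ℝ} (ht : t ∈ Icc (0 : ℝ) 1) :
    HasDerivWithinAt f (derivWithin f (Icc 0 1) t) (Icc 0 1) t :=
  (hf.differentiableOn (by simp) t ht).hasDerivWithinAt

theorem smooth_derivWithin {E : Type*} [NormedAddCommGroup E] [NormedSpace ℝ E]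
    {f : ℝ → E} (hf : ContDiffOn ℝ ∞ f (Icc 0 1)) :
    ContDiffOn ℝ ∞ (derivWithin f (Icc 0 1)) (Icc 0 1) :=
  hf.derivWithin uniqueDiffOn_unitInterval (by simp)

theorem HasDerivWithinAt.hasDerivAt_of_mem_Ioo {E : Type*} [NormedAddCommGroup E]
    [NormedSpace ℝ E] {f : ℝ → E} {f' : E} {t : ℝ} (h : HasDerivWithinAt f f' (Icc 0 1) t)
    (ht : t ∈ Ioo (0 : ℝ) 1) : HasDerivAt f f' t :=
  h.hasDerivAt (Icc_mem_nhds ht.1 ht.2)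

section Integral

variable {E : Type*} [NormedAddCommGroup E] [NormedSpace ℝ E] [CompleteSpace E]

theorem integral_eq_sub_of_hasDerivWithinAt {f f' : ℝ → E}
    (hf : ∀ t ∈ Icc (0 : ℝ) 1, HasDerivWithinAt f (f' t) (Icc 0 1) t)
    (hf' : ContinuousOn f' (Icc 0 1)) {T : ℝ} (hT : T ∈ Icc (0 : ℝ) 1) :
    ∫ t in (0 : ℝ)..T, f' t = f T - f 0 := by
  have hsub : Icc 0 T ⊆ Icc (0 : ℝ) 1 := Icc_subset_Icc_right hT.2
  refine intervalIntegral.integral_eq_sub_of_hasDerivAt_of_le hT.1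
    (fun t ht => ((hf t (hsub ht)).continuousWithinAt).mono hsub)
    (fun t ht => (hf t (hsub (Ioo_subset_Icc_self ht))).hasDerivAt
      (Icc_mem_nhds ht.1 (ht.2.trans_le hT.2)))
    (ContinuousOn.intervalIntegrable_of_Icc hT.1 (hf'.mono hsub))

theorem hasDerivWithinAt_primitive {g : ℝ → E} (hg : ContinuousOn g (Icc 0 1)) {t : ℝ}
    (ht : t ∈ Icc (0 : ℝ) 1) :
    HasDerivWithinAt (fun T => ∫ τ in (0 : ℝ)..T, g τ) (g t) (Icc 0 1) t := by
  -- This instance lets the fundamental theorem of calculus be used within `Icc 0 1`, end points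
  -- included.
  have : Fact (t ∈ Icc (0 : ℝ) 1) := ⟨ht⟩
  exact intervalIntegral.integral_hasDerivWithinAt_right
    (ContinuousOn.intervalIntegrable_of_Icc ht.1 (hg.mono (Icc_subset_Icc_right ht.2)))
    (hg.stronglyMeasurableAtFilter_nhdsWithin measurableSet_Icc t) (hg t ht)

theorem smooth_primitive {g : ℝ → E} (hg : ContDiffOn ℝ ∞ g (Icc 0 1)) :
    ContDiffOn ℝ ∞ (fun T => ∫ τ in (0 : ℝ)..T, g τ) (Icc 0 1) := by
  have h := fun t ht => hasDerivWithinAt_primitive hg.continuousOn (t := t) ht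
  rw [contDiffOn_infty_iff_derivWithin uniqueDiffOn_unitInterval]
  exact ⟨fun t ht => (h t ht).differentiableWithinAt,
    hg.congr fun t ht => (h t ht).derivWithin (uniqueDiffOn_unitInterval t ht)⟩

end Integral

theorem eq_of_hasDerivWithinAt_zero {f : ℝ → ℝ}
    (hf : ∀ t ∈ Icc (0 : ℝ) 1, HasDerivWithinAt f 0 (Icc 0 1) t) {t : ℝ}
    (ht : t ∈ Icc (0 : ℝ) 1) : f t = f 0 := by
  have := integral_eq_sub_of_hasDerivWithinAt (f' := fun _ => 0) hf continuousOn_const ht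
  simp only [intervalIntegral.integral_zero] at this
  linarith

/-- A continuous nonnegative function with zero integral vanishes. -/
theorem eq_zero_of_integral_eq_zero {f : ℝ → ℝ} (hf : ContinuousOn f (Icc 0 1))
    (h0 : ∀ t ∈ Icc (0 : ℝ) 1, 0 ≤ f t) (hint : ∫ t in (0 : ℝ)..1, f t = 0) :
    ∀ t ∈ Icc (0 : ℝ) 1, f t = 0 := by
  intro t ht
  by_contra hne
  have := intervalIntegral.integral_lt_integral_of_continuousOn_of_le_of_exists_lt
    (f := fun _ => 0) zero_lt_one continuousOn_const hf
    (fun x hx => h0 x (Ioc_subset_Icc_self hx)) ⟨t, ht, (h0 t ht).lt_of_ne' hne⟩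
  simp [hint] at this

/-! ### Coordinates of curves -/

theorem hasDerivWithinAt_coord {f : ℝ → Plane} {f' : Plane} {s : Set ℝ} {t : ℝ}
    (h : HasDerivWithinAt f f' s t) (i : Fin 2) :
    HasDerivWithinAt (fun τ => f τ i) (f' i) s t :=
  (EuclideanSpace.proj (𝕜 := ℝ) i).hasFDerivAt.comp_hasDerivWithinAt t h

theorem plane_norm_sq (v : Plane) : ‖v‖ ^ 2 = v 0 ^ 2 + v 1 ^ 2 := by
  simp [EuclideanSpace.norm_sq_eq, Fin.sum_univ_two]

section Smooth

variable {γ : ℝ → Plane} (hγ : ContDiffOn ℝ ∞ γ (Icc 0 1))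
include hγ

theorem smooth_vel : ContDiffOn ℝ ∞ (vel γ) (Icc 0 1) := smooth_derivWithin hγ

theorem smooth_acc : ContDiffOn ℝ ∞ (acc γ) (Icc 0 1) := smooth_derivWithin (smooth_vel hγ)

theorem hasDerivWithinAt_curve_coord {t : ℝ} (ht : t ∈ Icc (0 : ℝ) 1) (i : Fin 2) :
    HasDerivWithinAt (fun τ => γ τ i) (vel γ t i) (Icc 0 1) t :=
  hasDerivWithinAt_coord (hasDerivWithinAt_of_smooth hγ ht) i

theorem hasDerivWithinAt_vel_coord {t : ℝ} (ht : t ∈ Icc (0 : ℝ) 1) (i : Fin 2) :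
    HasDerivWithinAt (fun τ => vel γ τ i) (acc γ t i) (Icc 0 1) t :=
  hasDerivWithinAt_coord (hasDerivWithinAt_of_smooth (smooth_vel hγ) ht) i

end Smooth

theorem smooth_coord {E : Type*} [NormedAddCommGroup E] [NormedSpace ℝ E] {s : Set E}
    {f : E → Plane} (hf : ContDiffOn ℝ ∞ f s) (i : Fin 2) :
    ContDiffOn ℝ ∞ (fun t => f t i) s :=
  contDiffOn_euclidean.1 hf i

theorem arcLength_zero (γ : ℝ → Plane) : arcLength γ 0 = 0 := by
  simp [arcLength]

namespace IsAdmissible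

variable {l L : ℝ} {γ : ℝ → Plane} (h : IsAdmissible l L γ)
include h

theorem speed_pos {t : ℝ} (ht : t ∈ Icc (0 : ℝ) 1) : 0 < ‖vel γ t‖ :=
  norm_pos_iff.2 (h.regular t ht)

theorem smooth_speed : ContDiffOn ℝ ∞ (fun t => ‖vel γ t‖) (Icc 0 1) :=
  (smooth_vel h.smooth).norm ℝ h.regular

theorem hasDerivWithinAt_speed {t : ℝ} (ht : t ∈ Icc (0 : ℝ) 1) :
    HasDerivWithinAt (fun τ => ‖vel γ τ‖)
      ((vel γ t 0 * acc γ t 0 + vel γ t 1 * acc γ t 1) / ‖vel γ t‖) (Icc 0 1) t := by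
  have h1 := hasDerivWithinAt_of_smooth h.smooth_speed ht
  have h2 := (((hasDerivWithinAt_vel_coord h.smooth ht 0).pow 2).add
    ((hasDerivWithinAt_vel_coord h.smooth ht 1).pow 2))
  have h3 := (h1.pow 2).congr (f₁ := (fun τ => vel γ τ 0) ^ 2 + (fun τ => vel γ τ 1) ^ 2)
    (fun τ _ => (plane_norm_sq _).symm) (plane_norm_sq _).symm
  have h4 := (uniqueDiffOn_unitInterval t ht).eq_deriv _ h2 h3
  refine h1.congr_deriv ?_
  rw [eq_div_iff (h.speed_pos ht).ne']
  norm_num at h4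
  linarith

theorem smooth_curvature : ContDiffOn ℝ ∞ (curvature γ) (Icc 0 1) := by
  have hv := smooth_vel h.smooth
  have ha := smooth_acc h.smooth
  exact (((smooth_coord hv 0).mul (smooth_coord ha 1)).sub
    ((smooth_coord hv 1).mul (smooth_coord ha 0))).div (h.smooth_speed.pow 3)
    fun t ht => (pow_pos (h.speed_pos ht) 3).ne'

theorem hasDerivWithinAt_arcLength {t : ℝ} (ht : t ∈ Icc (0 : ℝ) 1) :
    HasDerivWithinAt (arcLength γ) ‖vel γ t‖ (Icc 0 1) t :=
  hasDerivWithinAt_primitive h.smooth_speed.continuousOn ht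

theorem arcLength_one : arcLength γ 1 = L := h.length_eq

theorem continuousOn_arcLength : ContinuousOn (arcLength γ) (Icc 0 1) :=
  fun _ ht => (h.hasDerivWithinAt_arcLength ht).continuousWithinAt

theorem strictMonoOn_arcLength : StrictMonoOn (arcLength γ) (Icc 0 1) := by
  refine strictMonoOn_of_deriv_pos (convex_Icc _ _) h.continuousOn_arcLength fun t ht => ?_
  rw [interior_Icc] at ht
  rw [(HasDerivWithinAt.hasDerivAt_of_mem_Ioo
    (h.hasDerivWithinAt_arcLength (Ioo_subset_Icc_self ht)) ht).deriv]
  exact h.speed_pos (Ioo_subset_Icc_self ht)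

theorem arcLength_mem {t : ℝ} (ht : t ∈ Icc (0 : ℝ) 1) : arcLength γ t ∈ Icc 0 L := by
  have := h.strictMonoOn_arcLength.monotoneOn
  constructor
  · simpa [arcLength_zero] using this (left_mem_Icc.2 zero_le_one) ht ht.1
  · simpa [h.arcLength_one] using this ht (right_mem_Icc.2 zero_le_one) ht.2

theorem surjOn_arcLength : SurjOn (arcLength γ) (Icc 0 1) (Icc 0 L) := by
  have := intermediate_value_Icc zero_le_one h.continuousOn_arcLength
  rwa [arcLength_zero, h.arcLength_one] at this

theorem arcLengthReparam_arcLength {t : ℝ} (ht : t ∈ Icc (0 : ℝ) 1) :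
    arcLengthReparam γ (arcLength γ t) = γ t := by
  rw [arcLengthReparam, h.strictMonoOn_arcLength.injOn.leftInvOn_invFunOn ht]

/-- Eliminates the inverse function: later arguments compare `γ` with `C ∘ arcLength γ` on `[0,1]`
and need only the chain rule. -/
theorem eqOn_arcLengthReparam_iff {C : ℝ → Plane} :
    EqOn (arcLengthReparam γ) C (Icc 0 L) ↔ ∀ t ∈ Icc (0 : ℝ) 1, γ t = C (arcLength γ t) := by
  constructor
  · intro H t ht
    rw [← H (h.arcLength_mem ht), h.arcLengthReparam_arcLength ht]
  · intro H s hs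
    obtain ⟨t, ht, rfl⟩ := h.surjOn_arcLength hs
    rw [h.arcLengthReparam_arcLength ht, H t ht]

end IsAdmissible

/-! ### Smooth functions on a strip `(-ε₀, ε₀) × [0, 1]` -/

/-- The parameter domain of a variation. -/
def strip (ε₀ : ℝ) : Set (ℝ × ℝ) := Ioo (-ε₀) ε₀ ×ˢ Icc 0 1

/-- Partial derivative in the family parameter. -/
noncomputable def parDeriv (ε₀ : ℝ) (f : ℝ × ℝ → ℝ) (q : ℝ × ℝ) : ℝ :=
  fderivWithin ℝ f (strip ε₀) q (1, 0)

/-- Partial derivative in the curve parameter. -/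
noncomputable def timeDeriv (ε₀ : ℝ) (f : ℝ × ℝ → ℝ) (q : ℝ × ℝ) : ℝ :=
  fderivWithin ℝ f (strip ε₀) q (0, 1)

theorem uniqueDiffOn_strip (ε₀ : ℝ) : UniqueDiffOn ℝ (strip ε₀) :=
  isOpen_Ioo.uniqueDiffOn.prod uniqueDiffOn_unitInterval

section Strip

variable {ε₀ : ℝ} {f : ℝ × ℝ → ℝ} (hf : ContDiffOn ℝ ∞ f (strip ε₀))
include hf

theorem smooth_parDeriv : ContDiffOn ℝ ∞ (parDeriv ε₀ f) (strip ε₀) :=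
  (hf.fderivWithin (uniqueDiffOn_strip ε₀) (by simp)).clm_apply contDiffOn_const

theorem smooth_timeDeriv : ContDiffOn ℝ ∞ (timeDeriv ε₀ f) (strip ε₀) :=
  (hf.fderivWithin (uniqueDiffOn_strip ε₀) (by simp)).clm_apply contDiffOn_const

theorem hasDerivWithinAt_timeDeriv {ε t : ℝ} (hε : ε ∈ Ioo (-ε₀) ε₀) (ht : t ∈ Icc (0 : ℝ) 1) :
    HasDerivWithinAt (fun τ => f (ε, τ)) (timeDeriv ε₀ f (ε, t)) (Icc 0 1) t := by
  have h := (hf.differentiableOn (by simp) (ε, t) ⟨hε, ht⟩).hasFDerivWithinAt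
  exact h.comp_hasDerivWithinAt t
    ((hasDerivWithinAt_const t _ ε).prodMk (hasDerivWithinAt_id t _)) fun τ hτ => ⟨hε, hτ⟩

theorem hasDerivAt_parDeriv {ε t : ℝ} (hε : ε ∈ Ioo (-ε₀) ε₀) (ht : t ∈ Icc (0 : ℝ) 1) :
    HasDerivAt (fun e => f (e, t)) (parDeriv ε₀ f (ε, t)) ε := by
  have h := (hf.differentiableOn (by simp) (ε, t) ⟨hε, ht⟩).hasFDerivWithinAt
  have := h.comp_hasDerivWithinAt ε (s := Ioo (-ε₀) ε₀)
    ((hasDerivWithinAt_id ε _).prodMk (hasDerivWithinAt_const ε _ t))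
    (show MapsTo _ _ (strip ε₀) from fun e he => ⟨he, ht⟩)
  exact this.hasDerivAt (Ioo_mem_nhds hε.1 hε.2)

theorem continuousOn_slice {ε : ℝ} (hε : ε ∈ Ioo (-ε₀) ε₀) :
    ContinuousOn (fun t => f (ε, t)) (Icc 0 1) :=
  hf.continuousOn.comp (f := fun t => (ε, t)) (by fun_prop)
    (show MapsTo _ _ (strip ε₀) from fun _ ht => ⟨hε, ht⟩)

theorem smooth_slice {ε : ℝ} (hε : ε ∈ Ioo (-ε₀) ε₀) :
    ContDiffOn ℝ ∞ (fun t => f (ε, t)) (Icc 0 1) :=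
  hf.comp (contDiffOn_const.prodMk contDiffOn_id) fun _ ht => ⟨hε, ht⟩

/-- Differentiation under the integral sign. -/
theorem hasDerivAt_integral_strip (hε₀ : 0 < ε₀) {T : ℝ} (hT : T ∈ Icc (0 : ℝ) 1) :
    HasDerivAt (fun ε => ∫ t in (0 : ℝ)..T, f (ε, t))
      (∫ t in (0 : ℝ)..T, parDeriv ε₀ f (0, t)) 0 := by
  have hsubT : Icc 0 T ⊆ Icc (0 : ℝ) 1 := Icc_subset_Icc_right hT.2
  have h0 : (0 : ℝ) ∈ Ioo (-ε₀) ε₀ := ⟨by linarith, hε₀⟩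
  -- Halving the parameter interval gives a compact rectangle, on which the parameter derivative has
  -- a constant bound.
  have hsub : Icc (-(ε₀ / 2)) (ε₀ / 2) ⊆ Ioo (-ε₀) ε₀ := fun e he =>
    ⟨by linarith [he.1], by linarith [he.2]⟩
  have hint : ∀ {g : ℝ × ℝ → ℝ}, ContDiffOn ℝ ∞ g (strip ε₀) → ∀ ε ∈ Ioo (-ε₀) ε₀,
      IntervalIntegrable (fun t => g (ε, t)) volume 0 T := fun hg ε hε =>
    ((continuousOn_slice hg hε).mono hsubT).intervalIntegrable_of_Icc hT.1
  have hcompact : IsCompact (Icc (-(ε₀ / 2)) (ε₀ / 2) ×ˢ Icc (0 : ℝ) 1) :=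
    isCompact_Icc.prod isCompact_Icc
  obtain ⟨M, hM⟩ := hcompact.exists_bound_of_continuousOn
    ((smooth_parDeriv hf).continuousOn.mono (prod_mono hsub subset_rfl))
  have hmem : ∀ t ∈ Set.uIoc 0 T, t ∈ Icc (0 : ℝ) 1 := fun t ht => by
    rw [uIoc_of_le hT.1] at ht
    exact hsubT (Ioc_subset_Icc_self ht)
  refine (intervalIntegral.hasDerivAt_integral_of_dominated_loc_of_deriv_le
    (F := fun ε t => f (ε, t)) (F' := fun ε t => parDeriv ε₀ f (ε, t)) (bound := fun _ => M)
    (Icc_mem_nhds (a := -(ε₀ / 2)) (b := ε₀ / 2) (by linarith) (by linarith))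
    ?_ (hint hf 0 h0) (hint (smooth_parDeriv hf) 0 h0).def'.aestronglyMeasurable
    ?_ (by simp) ?_).2
  · filter_upwards [Ioo_mem_nhds h0.1 h0.2] with ε hε
    exact (hint hf ε hε).def'.aestronglyMeasurable
  · exact .of_forall fun t ht ε hε => hM (ε, t) ⟨hε, hmem t ht⟩
  · exact .of_forall fun t ht ε hε => hasDerivAt_parDeriv hf (hsub hε) (hmem t ht)

/-- The mixed partial derivatives agree, also on the boundary of the strip. -/
theorem hasDerivWithinAt_parDeriv (hε₀ : 0 < ε₀) {t : ℝ} (ht : t ∈ Icc (0 : ℝ) 1) :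
    HasDerivWithinAt (fun τ => parDeriv ε₀ f (0, τ)) (parDeriv ε₀ (timeDeriv ε₀ f) (0, t))
      (Icc 0 1) t := by
  have h0 : (0 : ℝ) ∈ Ioo (-ε₀) ε₀ := ⟨by linarith, hε₀⟩
  have hd := smooth_timeDeriv hf
  -- Differentiate `f (ε, T) - f (ε, 0) = ∫ timeDeriv` under the integral sign. No symmetry of
  -- second derivatives at boundary points is invoked.
  have key : ∀ T ∈ Icc (0 : ℝ) 1, parDeriv ε₀ f (0, T) =
      (∫ τ in (0 : ℝ)..T, parDeriv ε₀ (timeDeriv ε₀ f) (0, τ)) + parDeriv ε₀ f (0, 0) := by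
    intro T hT
    have h1 := hasDerivAt_integral_strip hd hε₀ hT
    have h2 := (hasDerivAt_parDeriv hf h0 hT).sub
      (hasDerivAt_parDeriv hf h0 (left_mem_Icc.2 zero_le_one))
    have h3 := h2.congr_of_eventuallyEq (f₁ := fun ε => ∫ τ in (0 : ℝ)..T, timeDeriv ε₀ f (ε, τ))
      (by
        filter_upwards [Ioo_mem_nhds h0.1 h0.2] with ε hε
        exact integral_eq_sub_of_hasDerivWithinAt (f := fun t => f (ε, t))
          (fun t ht => hasDerivWithinAt_timeDeriv hf hε ht) (continuousOn_slice hd hε) hT)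
    have := h1.unique h3
    linarith
  exact ((hasDerivWithinAt_primitive
    (continuousOn_slice (smooth_parDeriv hd) h0) ht).add_const _).congr key (key t ht)

end Strip

/-! ### The first variation of the elastic energy -/

/-- Two expressions for the density of the first variation of the energy: by the quotient rule, and
through the variation of the tangent angle. -/
theorem first_variation_density_identity {a b a' b' α β α' β' n : ℝ} (hn : 0 < n)
    (hn2 : n ^ 2 = a ^ 2 + b ^ 2) :
    2 * ((a * b' - b * a') / n ^ 3) *
          (((α * b' + a * β' - (β * a' + b * α')) * n ^ 3 -
            (a * b' - b * a') * (3 * n ^ 2 * ((a * α + b * β) / n))) / (n ^ 3) ^ 2) * n +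
        ((a * b' - b * a') / n ^ 3) ^ 2 * ((a * α + b * β) / n) =
      2 * ((a * b' - b * a') / n ^ 3) *
          (((a' * β + a * β' - (b' * α + b * α')) * n ^ 2 -
            (a * β - b * α) * (2 * n * ((a * a' + b * b') / n))) / (n ^ 2) ^ 2) -
        ((a * b' - b * a') / n ^ 3) ^ 2 * ((a * α + b * β) / n) := by
  -- For plane vectors `v`, `u`, `w`: `(v·u)(v∧w) - (v∧u)(v·w) = |v|² (u∧w)`. After clearing
  -- denominators, the two densities differ by a multiple of this relation.
  have key : (a * α + b * β) * (a * b' - b * a') - (a * β - b * α) * (a * a' + b * b') =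
      n ^ 2 * (b' * α - a' * β) := by rw [hn2]; ring
  have h0 := hn.ne'
  field_simp
  linear_combination (-4 * (a * b' - b * a')) * key

theorem vel_congr {γ₁ γ₂ : ℝ → Plane} (h : EqOn γ₁ γ₂ (Icc 0 1)) :
    EqOn (vel γ₁) (vel γ₂) (Icc 0 1) :=
  fun _ ht => derivWithin_congr h (h ht)

theorem acc_congr {γ₁ γ₂ : ℝ → Plane} (h : EqOn γ₁ γ₂ (Icc 0 1)) :
    EqOn (acc γ₁) (acc γ₂) (Icc 0 1) :=
  fun _ ht => derivWithin_congr (vel_congr h) (vel_congr h ht)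

namespace IsVariation

variable {l L : ℝ} {γ : ℝ → Plane} {ε₀ : ℝ} {Γ : ℝ → ℝ → Plane} (hΓ : IsVariation l L γ ε₀ Γ)
include hΓ

theorem smooth_coord (i : Fin 2) :
    ContDiffOn ℝ ∞ (fun q : ℝ × ℝ => Γ q.1 q.2 i) (strip ε₀) :=
  PinnedElastica.smooth_coord hΓ.smooth i

theorem vel_coord {ε t : ℝ} (hε : ε ∈ Ioo (-ε₀) ε₀) (ht : t ∈ Icc (0 : ℝ) 1) (i : Fin 2) :
    vel (Γ ε) t i = timeDeriv ε₀ (fun q => Γ q.1 q.2 i) (ε, t) :=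
  (uniqueDiffOn_unitInterval t ht).eq_deriv _
    (hasDerivWithinAt_curve_coord (hΓ.admissible ε hε).smooth ht i)
    (hasDerivWithinAt_timeDeriv (hΓ.smooth_coord i) hε ht)

theorem acc_coord {ε t : ℝ} (hε : ε ∈ Ioo (-ε₀) ε₀) (ht : t ∈ Icc (0 : ℝ) 1) (i : Fin 2) :
    acc (Γ ε) t i = timeDeriv ε₀ (timeDeriv ε₀ fun q => Γ q.1 q.2 i) (ε, t) :=
  (uniqueDiffOn_unitInterval t ht).eq_deriv _
    (hasDerivWithinAt_vel_coord (hΓ.admissible ε hε).smooth ht i)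
    ((hasDerivWithinAt_timeDeriv (smooth_timeDeriv (hΓ.smooth_coord i)) hε ht).congr
      (fun _ hτ => hΓ.vel_coord hε hτ i) (hΓ.vel_coord hε ht i))

theorem zero_mem : (0 : ℝ) ∈ Ioo (-ε₀) ε₀ := ⟨by linarith [hΓ.pos], hΓ.pos⟩

/-- First variation of the elastic energy. Here `(P, Q)` is the variation field, `(α, β)` its
derivative, and `Θ'` the derivative of the variation of the tangent angle. -/
theorem first_variation :
    ∃ P Q α β Θ' : ℝ → ℝ,
      (∀ t ∈ Icc (0 : ℝ) 1, HasDerivAt (fun ε => Γ ε t 0) (P t) 0) ∧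
      (∀ t ∈ Icc (0 : ℝ) 1, HasDerivAt (fun ε => Γ ε t 1) (Q t) 0) ∧
      (∀ t ∈ Icc (0 : ℝ) 1, HasDerivWithinAt P (α t) (Icc 0 1) t) ∧
      (∀ t ∈ Icc (0 : ℝ) 1, HasDerivWithinAt Q (β t) (Icc 0 1) t) ∧
      ContinuousOn α (Icc 0 1) ∧ ContinuousOn β (Icc 0 1) ∧
      (∀ t ∈ Icc (0 : ℝ) 1, HasDerivWithinAt
        (fun τ => (vel γ τ 0 * β τ - vel γ τ 1 * α τ) / ‖vel γ τ‖ ^ 2) (Θ' t) (Icc 0 1) t) ∧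
      ContinuousOn Θ' (Icc 0 1) ∧
      (∫ t in (0 : ℝ)..1, (vel γ t 0 * α t + vel γ t 1 * β t) / ‖vel γ t‖) = 0 ∧
      HasDerivAt (fun ε => elasticEnergy (Γ ε))
        (∫ t in (0 : ℝ)..1, (2 * curvature γ t * Θ' t -
          curvature γ t ^ 2 * ((vel γ t 0 * α t + vel γ t 1 * β t) / ‖vel γ t‖))) 0 := by
  have h0 := hΓ.zero_mem
  have hnhds : Ioo (-ε₀) ε₀ ∈ nhds (0 : ℝ) := Ioo_mem_nhds h0.1 h0.2
  set X : ℝ × ℝ → ℝ := fun q => Γ q.1 q.2 0 with hX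
  set Y : ℝ × ℝ → ℝ := fun q => Γ q.1 q.2 1 with hY
  have sX : ContDiffOn ℝ ∞ X (strip ε₀) := hΓ.smooth_coord 0
  have sY : ContDiffOn ℝ ∞ Y (strip ε₀) := hΓ.smooth_coord 1
  set a := timeDeriv ε₀ X with ha
  set b := timeDeriv ε₀ Y with hb
  have sa : ContDiffOn ℝ ∞ a (strip ε₀) := smooth_timeDeriv sX
  have sb : ContDiffOn ℝ ∞ b (strip ε₀) := smooth_timeDeriv sY
  set a' := timeDeriv ε₀ a with ha'
  set b' := timeDeriv ε₀ b with hb'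
  have sa' : ContDiffOn ℝ ∞ a' (strip ε₀) := smooth_timeDeriv sa
  have sb' : ContDiffOn ℝ ∞ b' (strip ε₀) := smooth_timeDeriv sb
  have va : ∀ {ε t}, ε ∈ Ioo (-ε₀) ε₀ → t ∈ Icc (0 : ℝ) 1 → vel (Γ ε) t 0 = a (ε, t) :=
    fun hε ht => hΓ.vel_coord hε ht 0
  have vb : ∀ {ε t}, ε ∈ Ioo (-ε₀) ε₀ → t ∈ Icc (0 : ℝ) 1 → vel (Γ ε) t 1 = b (ε, t) :=
    fun hε ht => hΓ.vel_coord hε ht 1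
  have aa : ∀ {ε t}, ε ∈ Ioo (-ε₀) ε₀ → t ∈ Icc (0 : ℝ) 1 → acc (Γ ε) t 0 = a' (ε, t) :=
    fun hε ht => hΓ.acc_coord hε ht 0
  have ab : ∀ {ε t}, ε ∈ Ioo (-ε₀) ε₀ → t ∈ Icc (0 : ℝ) 1 → acc (Γ ε) t 1 = b' (ε, t) :=
    fun hε ht => hΓ.acc_coord hε ht 1
  set n : ℝ × ℝ → ℝ := fun q => √(a q ^ 2 + b q ^ 2) with hn
  have vn : ∀ {ε t}, ε ∈ Ioo (-ε₀) ε₀ → t ∈ Icc (0 : ℝ) 1 → ‖vel (Γ ε) t‖ = n (ε, t) := by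
    intro ε t hε ht
    simp only [hn]
    rw [← va hε ht, ← vb hε ht, ← plane_norm_sq, Real.sqrt_sq (norm_nonneg _)]
  have npos : ∀ q ∈ strip ε₀, 0 < n q := by
    rintro ⟨ε, t⟩ ⟨hε, ht⟩
    rw [← vn hε ht]
    exact (hΓ.admissible ε hε).speed_pos ht
  have nsq : ∀ q ∈ strip ε₀, n q ^ 2 = a q ^ 2 + b q ^ 2 := fun q _ =>
    Real.sq_sqrt (by positivity)
  have sn : ContDiffOn ℝ ∞ n (strip ε₀) :=
    ((sa.pow 2).add (sb.pow 2)).sqrt fun q hq => by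
      rw [← nsq q hq]; exact (pow_pos (npos q hq) 2).ne'
  set F : ℝ × ℝ → ℝ := fun q => ((a q * b' q - b q * a' q) / n q ^ 3) ^ 2 * n q with hF
  have sF : ContDiffOn ℝ ∞ F (strip ε₀) :=
    ((((sa.mul sb').sub (sb.mul sa')).div (sn.pow 3)
      fun q hq => (pow_pos (npos q hq) 3).ne').pow 2).mul sn
  -- partial derivatives at `ε = 0`
  have dn : ∀ t ∈ Icc (0 : ℝ) 1, parDeriv ε₀ n (0, t) =
      (a (0, t) * parDeriv ε₀ a (0, t) + b (0, t) * parDeriv ε₀ b (0, t)) / n (0, t) := by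
    intro t ht
    have h1 := ((hasDerivAt_parDeriv sn h0 ht).pow 2)
    have h2 := ((hasDerivAt_parDeriv sa h0 ht).pow 2).add ((hasDerivAt_parDeriv sb h0 ht).pow 2)
    have h3 := h1.unique (h2.congr_of_eventuallyEq (by
      filter_upwards [hnhds] with ε hε
      exact nsq (ε, t) ⟨hε, ht⟩))
    rw [eq_div_iff (npos (0, t) ⟨h0, ht⟩).ne']
    norm_num at h3
    linarith
  have dnt : ∀ t ∈ Icc (0 : ℝ) 1, timeDeriv ε₀ n (0, t) =
      (a (0, t) * a' (0, t) + b (0, t) * b' (0, t)) / n (0, t) := by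
    intro t ht
    have h1 := ((hasDerivWithinAt_timeDeriv sn h0 ht).pow 2)
    have h2 := ((hasDerivWithinAt_timeDeriv sa h0 ht).pow 2).add
      ((hasDerivWithinAt_timeDeriv sb h0 ht).pow 2)
    have h3 := (uniqueDiffOn_unitInterval t ht).eq_deriv _ h1 (h2.congr
      (fun τ hτ => nsq (0, τ) ⟨h0, hτ⟩) (nsq (0, t) ⟨h0, ht⟩))
    rw [eq_div_iff (npos (0, t) ⟨h0, ht⟩).ne']
    norm_num at h3
    linarith
  have base_vel := vel_congr hΓ.base
  have base_acc := acc_congr hΓ.base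
  -- The tangent angle varies at the rate `(γ' ∧ δγ') / |γ'|²`; this form avoids choosing an angle
  -- function.
  set Θ : ℝ → ℝ := fun t =>
    (a (0, t) * parDeriv ε₀ b (0, t) - b (0, t) * parDeriv ε₀ a (0, t)) / n (0, t) ^ 2 with hΘ
  have sΘ : ContDiffOn ℝ ∞ Θ (Icc 0 1) :=
    (((smooth_slice sa h0).mul (smooth_slice (smooth_parDeriv sb) h0)).sub
      ((smooth_slice sb h0).mul (smooth_slice (smooth_parDeriv sa) h0))).div
      ((smooth_slice sn h0).pow 2) fun t ht => (pow_pos (npos (0, t) ⟨h0, ht⟩) 2).ne'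
  have dΘ : ∀ t ∈ Icc (0 : ℝ) 1, derivWithin Θ (Icc 0 1) t = _ := fun t ht =>
    ((((hasDerivWithinAt_timeDeriv sa h0 ht).mul (hasDerivWithinAt_parDeriv sb hΓ.pos ht)).sub
      ((hasDerivWithinAt_timeDeriv sb h0 ht).mul (hasDerivWithinAt_parDeriv sa hΓ.pos ht))).div
      ((hasDerivWithinAt_timeDeriv sn h0 ht).pow 2)
        (pow_pos (npos (0, t) ⟨h0, ht⟩) 2).ne').derivWithin (uniqueDiffOn_unitInterval t ht)
  have dF : ∀ t ∈ Icc (0 : ℝ) 1, parDeriv ε₀ F (0, t) = _ := fun t ht =>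
    (hasDerivAt_parDeriv sF h0 ht).unique
      ((((((hasDerivAt_parDeriv sa h0 ht).mul (hasDerivAt_parDeriv sb' h0 ht)).sub
      ((hasDerivAt_parDeriv sb h0 ht).mul (hasDerivAt_parDeriv sa' h0 ht))).div
      ((hasDerivAt_parDeriv sn h0 ht).pow 3)
        (pow_pos (npos (0, t) ⟨h0, ht⟩) 3).ne').pow 2).mul (hasDerivAt_parDeriv sn h0 ht))
  refine ⟨fun t => parDeriv ε₀ X (0, t), fun t => parDeriv ε₀ Y (0, t),
    fun t => parDeriv ε₀ a (0, t), fun t => parDeriv ε₀ b (0, t), derivWithin Θ (Icc 0 1),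
    fun t ht => hasDerivAt_parDeriv sX h0 ht, fun t ht => hasDerivAt_parDeriv sY h0 ht,
    fun t ht => hasDerivWithinAt_parDeriv sX hΓ.pos ht,
    fun t ht => hasDerivWithinAt_parDeriv sY hΓ.pos ht,
    continuousOn_slice (smooth_parDeriv sa) h0, continuousOn_slice (smooth_parDeriv sb) h0,
    ?_, (smooth_derivWithin sΘ).continuousOn, ?_, ?_⟩
  · intro t ht
    refine (hasDerivWithinAt_of_smooth sΘ ht).congr (fun τ hτ => ?_) ?_
    · rw [← base_vel hτ, va h0 hτ, vb h0 hτ, vn h0 hτ]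
    · rw [← base_vel ht, va h0 ht, vb h0 ht, vn h0 ht]
  · have h1 := hasDerivAt_integral_strip sn hΓ.pos (right_mem_Icc.2 zero_le_one)
    -- Every curve of the family has length `L`, so the variation of length is zero.
    have h2 : HasDerivAt (fun ε => ∫ t in (0 : ℝ)..1, n (ε, t)) 0 0 := by
      refine (hasDerivAt_const (0 : ℝ) L).congr_of_eventuallyEq ?_
      filter_upwards [hnhds] with ε hε
      rw [← (hΓ.admissible ε hε).length_eq, length, arcLength]
      refine intervalIntegral.integral_congr fun t ht => ?_
      rw [uIcc_of_le zero_le_one] at ht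
      exact (vn hε ht).symm
    refine Eq.trans (intervalIntegral.integral_congr fun t ht => ?_) (h1.unique h2)
    rw [uIcc_of_le zero_le_one] at ht
    simp only
    rw [dn t ht, ← base_vel ht, va h0 ht, vb h0 ht, vn h0 ht]
  · have h1 := hasDerivAt_integral_strip sF hΓ.pos (right_mem_Icc.2 zero_le_one)
    refine (h1.congr_of_eventuallyEq ?_).congr_deriv ?_
    · filter_upwards [hnhds] with ε hε
      rw [elasticEnergy]
      refine intervalIntegral.integral_congr fun t ht => ?_
      rw [uIcc_of_le zero_le_one] at ht
      simp only [curvature, hF]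
      rw [va hε ht, vb hε ht, aa hε ht, ab hε ht, vn hε ht]
    · refine intervalIntegral.integral_congr fun t ht => ?_
      rw [uIcc_of_le zero_le_one] at ht
      have hid := first_variation_density_identity (α := parDeriv ε₀ a (0, t))
        (β := parDeriv ε₀ b (0, t)) (α' := parDeriv ε₀ a' (0, t)) (β' := parDeriv ε₀ b' (0, t))
        (a' := a' (0, t)) (b' := b' (0, t))
        (npos (0, t) ⟨h0, ht⟩) (nsq (0, t) ⟨h0, ht⟩)
      simp only [curvature]
      rw [dF t ht, dΘ t ht, ← base_vel ht, ← base_acc ht, va h0 ht, vb h0 ht, vn h0 ht, aa h0 ht,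
        ab h0 ht, dn t ht, dnt t ht]
      simp only [Pi.mul_apply, Pi.sub_apply, Pi.pow_apply, Pi.div_apply]
      norm_num
      linarith [hid]

end IsVariation

/-! ### Frenet equations and sufficiency of `κ = -lam * y` -/

namespace IsAdmissible

variable {l L : ℝ} {γ : ℝ → Plane} (h : IsAdmissible l L γ)
include h

/-- Frenet equation for the first component of the unit tangent. -/
theorem hasDerivWithinAt_tangent_zero {t : ℝ} (ht : t ∈ Icc (0 : ℝ) 1) :
    HasDerivWithinAt (fun τ => vel γ τ 0 / ‖vel γ τ‖) (-(curvature γ t * vel γ t 1))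
      (Icc 0 1) t := by
  have hn := h.speed_pos ht
  refine ((hasDerivWithinAt_vel_coord h.smooth ht 0).div (h.hasDerivWithinAt_speed ht)
    hn.ne').congr_deriv ?_
  have hsq := plane_norm_sq (vel γ t)
  rw [curvature]
  field_simp
  rw [hsq]; ring

/-- Frenet equation for the second component of the unit tangent. -/
theorem hasDerivWithinAt_tangent_one {t : ℝ} (ht : t ∈ Icc (0 : ℝ) 1) :
    HasDerivWithinAt (fun τ => vel γ τ 1 / ‖vel γ τ‖) (curvature γ t * vel γ t 0)
      (Icc 0 1) t := by
  have hn := h.speed_pos ht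
  refine ((hasDerivWithinAt_vel_coord h.smooth ht 1).div (h.hasDerivWithinAt_speed ht)
    hn.ne').congr_deriv ?_
  have hsq := plane_norm_sq (vel γ t)
  rw [curvature]
  field_simp
  rw [hsq]; ring

/-- The first integral of the equation `κ = -lam y`. -/
theorem curvature_sq_eq {lam : ℝ}
    (hκ : ∀ t ∈ Icc (0 : ℝ) 1, curvature γ t = -lam * γ t 1) :
    ∃ C : ℝ, ∀ t ∈ Icc (0 : ℝ) 1,
      curvature γ t ^ 2 = 2 * lam * (vel γ t 0 / ‖vel γ t‖) + C := by
  refine ⟨(-lam * γ 0 1) ^ 2 - 2 * lam * (vel γ 0 0 / ‖vel γ 0‖), fun t ht => ?_⟩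
  have := eq_of_hasDerivWithinAt_zero
    (f := fun t => (-lam * γ t 1) ^ 2 - 2 * lam * (vel γ t 0 / ‖vel γ t‖)) (fun t ht => by
      refine ((((hasDerivWithinAt_curve_coord h.smooth ht 1).const_mul (-lam)).pow 2).sub
        ((h.hasDerivWithinAt_tangent_zero ht).const_mul (2 * lam))).congr_deriv ?_
      rw [hκ t ht]; norm_num; ring) ht
  simp only at this
  rw [hκ t ht]
  linarith

end IsAdmissible

/-- Pinned curves with `κ = -lam y` are critical. -/
theorem isCriticalPoint_of_curvature_eq {l L lam : ℝ} {γ : ℝ → Plane} (h : IsAdmissible l L γ)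
    (hκ : ∀ t ∈ Icc (0 : ℝ) 1, curvature γ t = -lam * γ t 1) : IsCriticalPoint l L γ := by
  refine ⟨h, fun ε₀ Γ hΓ => ?_⟩
  obtain ⟨P, Q, α, β, Θ', hP, -, hP', -, hα, hβ, hΘ, hΘc, hlen, hE⟩ := hΓ.first_variation
  obtain ⟨C, hC⟩ := h.curvature_sq_eq hκ
  have hnhds : Ioo (-ε₀) ε₀ ∈ nhds (0 : ℝ) := Ioo_mem_nhds hΓ.zero_mem.1 hΓ.zero_mem.2
  have hm0 : (0 : ℝ) ∈ Icc (0 : ℝ) 1 := left_mem_Icc.2 zero_le_one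
  have hm1 : (1 : ℝ) ∈ Icc (0 : ℝ) 1 := right_mem_Icc.2 zero_le_one
  have hP0 : P 0 = 0 := (hP 0 hm0).unique ((hasDerivAt_const (0 : ℝ) (0 : ℝ)).congr_of_eventuallyEq
    (by filter_upwards [hnhds] with ε hε; simp [(hΓ.admissible ε hε).start]))
  have hP1 : P 1 = 0 := (hP 1 hm1).unique ((hasDerivAt_const (0 : ℝ) l).congr_of_eventuallyEq
    (by filter_upwards [hnhds] with ε hε; simp [(hΓ.admissible ε hε).finish]))
  have hvc : ∀ i, ContinuousOn (fun t => vel γ t i) (Icc 0 1) := fun i =>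
    (smooth_coord (smooth_vel h.smooth) i).continuousOn
  have hN : ContinuousOn (fun t => (vel γ t 0 * α t + vel γ t 1 * β t) / ‖vel γ t‖) (Icc 0 1) :=
    (((hvc 0).mul hα).add ((hvc 1).mul hβ)).div h.smooth_speed.continuousOn
      fun t ht => (h.speed_pos ht).ne'
  set Θ : ℝ → ℝ := fun τ => (vel γ τ 0 * β τ - vel γ τ 1 * α τ) / ‖vel γ τ‖ ^ 2 with hΘdef
  have hcΘ : ContinuousOn Θ (Icc 0 1) := fun t ht => (hΘ t ht).continuousWithinAt
  have hyc : ContinuousOn (fun t => γ t 1) (Icc 0 1) :=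
    (smooth_coord h.smooth 1).continuousOn
  -- The derivative of `2 κ Θ - 2 lam P`, which vanishes at both ends because `y = 0` and `P = 0`
  -- there.
  set G' : ℝ → ℝ := fun t => 2 * (-lam * vel γ t 1 * Θ t + -lam * γ t 1 * Θ' t) - 2 * lam * α t
    with hG'def
  have hG'c : ContinuousOn G' (Icc 0 1) :=
    (continuousOn_const.mul (((continuousOn_const.mul (hvc 1)).mul hcΘ).add
      ((continuousOn_const.mul hyc).mul hΘc))).sub (continuousOn_const.mul hα)
  have hG' := integral_eq_sub_of_hasDerivWithinAt
    (f := fun t => 2 * (-lam * γ t 1 * Θ t) - 2 * lam * P t) (f' := G')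
    (fun t ht => (((((hasDerivWithinAt_curve_coord h.smooth ht 1).const_mul (-lam)).mul
      (hΘ t ht)).const_mul 2).sub ((hP' t ht).const_mul (2 * lam)))) hG'c hm1
  refine hE.congr_deriv ?_
  have hcongr : ∫ t in (0 : ℝ)..1, (2 * curvature γ t * Θ' t -
        curvature γ t ^ 2 * ((vel γ t 0 * α t + vel γ t 1 * β t) / ‖vel γ t‖)) =
      ∫ t in (0 : ℝ)..1, (G' t - C * ((vel γ t 0 * α t + vel γ t 1 * β t) / ‖vel γ t‖)) := by
    refine intervalIntegral.integral_congr fun t ht => ?_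
    rw [uIcc_of_le zero_le_one] at ht
    have hn := (h.speed_pos ht).ne'
    -- Horizontal component of the splitting `δγ' = δ|γ'| T + Θ iγ'` into tangential and normal
    -- parts.
    have hid : vel γ t 0 / ‖vel γ t‖ * ((vel γ t 0 * α t + vel γ t 1 * β t) / ‖vel γ t‖) =
        vel γ t 1 * Θ t + α t := by
      have hsq := plane_norm_sq (vel γ t)
      simp only [hΘdef]
      field_simp
      rw [hsq]; ring
    simp only [hC t ht, hG'def]
    rw [← hκ t ht]
    linear_combination (-2 * lam) * hid
  rw [hcongr, intervalIntegral.integral_sub (hG'c.intervalIntegrable_of_Icc zero_le_one)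
    ((hN.intervalIntegrable_of_Icc zero_le_one).const_mul C),
    intervalIntegral.integral_const_mul, hlen, hG', hP0, hP1, h.start, h.finish]
  simp

/-! ### Bending a curve -/

/-- A version of the implicit function theorem for real functions of two variables. -/
theorem exists_smooth_implicit {G : ℝ × ℝ → ℝ} (hG : ContDiff ℝ ω G) (h0 : G (0, 0) = 0)
    {d : ℝ} (hd : HasDerivAt (fun s => G (0, s)) d 0) (hd0 : d ≠ 0) {U : Set (ℝ × ℝ)}
    (hU : U ∈ nhds ((0 : ℝ), (0 : ℝ))) :
    ∃ (ε₀ : ℝ) (s : ℝ → ℝ), 0 < ε₀ ∧ s 0 = 0 ∧ ContDiffOn ℝ ∞ s (Ioo (-ε₀) ε₀) ∧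
      ∀ ε ∈ Ioo (-ε₀) ε₀, G (ε, s ε) = 0 ∧ (ε, s ε) ∈ U := by
  have hc : ContDiffAt ℝ ω G ((0 : ℝ), (0 : ℝ)) := hG.contDiffAt
  have hω : (ω : WithTop ℕ∞) ≠ 0 := by simp
  have hdir : fderiv ℝ G (0, 0) (0, 1) = d := by
    have h1 := (hc.differentiableAt hω).hasFDerivAt.comp_hasDerivAt (0 : ℝ)
      ((hasDerivAt_const (0 : ℝ) (0 : ℝ)).prodMk (hasDerivAt_id (0 : ℝ)))
    exact h1.unique hd
  have hinv : (fderiv ℝ G (0, 0) ∘L .inr ℝ ℝ ℝ).IsInvertible := by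
    refine ⟨ContinuousLinearEquiv.smulLeft (Units.mk0 d hd0), ?_⟩
    ext
    simp [hdir, Units.smul_def]
  have hs0 : hc.implicitFunction hω hinv 0 = 0 := hc.implicitFunction_apply_self hω hinv
  have hs : ContDiffAt ℝ ω (hc.implicitFunction hω hinv) 0 := hc.contDiffAt_implicitFunction hω hinv
  have hev := hc.eventually_apply_implicitFunction hω hinv
  -- This is why `G` is analytic: regularity `ω` at a point persists on a neighbourhood, whereas
  -- `ContDiffAt ℝ ∞` at a point provides no common neighbourhood for all orders.
  have hsm := hs.eventually (by simp)
  have hUe : ∀ᶠ ε in nhds (0 : ℝ), (ε, hc.implicitFunction hω hinv ε) ∈ U := by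
    have : ContinuousAt (fun ε => (ε, hc.implicitFunction hω hinv ε)) (0 : ℝ) :=
      continuousAt_id.prodMk hs.continuousAt
    exact this (by simpa only [hs0] using hU)
  obtain ⟨ε₀, hε₀, h⟩ := Metric.eventually_nhds_iff_ball.1 (hev.and (hsm.and hUe))
  rw [Real.ball_eq_Ioo, zero_sub, zero_add] at h
  refine ⟨ε₀, hc.implicitFunction hω hinv, hε₀, hs0,
    fun ε hε => ((h ε hε).2.1.of_le le_top).contDiffWithinAt,
    fun ε hε => ⟨(h ε hε).1.trans h0, (h ε hε).2.2⟩⟩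

/-- The plane vector with the coordinates of a complex number. -/
noncomputable def toPlane (z : ℂ) : Plane := !₂[z.re, z.im]

/-- The complex number with the coordinates of a plane vector. -/
def toComplex (v : Plane) : ℂ := ⟨v 0, v 1⟩

theorem toPlane_apply_zero (z : ℂ) : toPlane z 0 = z.re := rfl

theorem toPlane_apply_one (z : ℂ) : toPlane z 1 = z.im := rfl

theorem toPlane_toComplex (v : Plane) : toPlane (toComplex v) = v := by
  ext i; fin_cases i <;> rfl

theorem norm_toPlane (z : ℂ) : ‖toPlane z‖ = ‖z‖ := by
  rw [← sq_eq_sq₀ (norm_nonneg _) (norm_nonneg _), plane_norm_sq, ← Complex.normSq_eq_norm_sq,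
    Complex.normSq_apply, toPlane_apply_zero, toPlane_apply_one]
  ring

theorem norm_toComplex (v : Plane) : ‖toComplex v‖ = ‖v‖ := by
  rw [← norm_toPlane, toPlane_toComplex]

/-- `toPlane` as a continuous linear map. -/
noncomputable def toPlaneCLM : ℂ →L[ℝ] Plane :=
  LinearMap.toContinuousLinearMap
    { toFun := toPlane
      map_add' := fun z w => by ext i; fin_cases i <;> simp [toPlane]
      map_smul' := fun c z => by ext i; fin_cases i <;> simp [toPlane] }

theorem toPlaneCLM_apply (z : ℂ) : toPlaneCLM z = toPlane z := rfl

/-- `toComplex` as a continuous linear map. -/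
noncomputable def toComplexCLM : Plane →L[ℝ] ℂ :=
  LinearMap.toContinuousLinearMap
    { toFun := toComplex
      map_add' := fun z w => by apply Complex.ext <;> simp [toComplex]
      map_smul' := fun c z => by apply Complex.ext <;> simp [toComplex] }

/-- The integral `∫₀ᵗ f γ'` as a complex number. -/
noncomputable def moment (γ : ℝ → Plane) (f : ℝ → ℝ) (t : ℝ) : ℂ :=
  ∫ τ in (0 : ℝ)..t, f τ • toComplex (vel γ τ)

theorem moment_zero (γ : ℝ → Plane) (f : ℝ → ℝ) : moment γ f 0 = 0 := by simp [moment]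

/-- The curve starting at `γ 0` with velocity `(1 + i (ε φ + s ψ))² γ'`. -/
noncomputable def bend (γ : ℝ → Plane) (φ ψ : ℝ → ℝ) (q : ℝ × ℝ) (t : ℝ) : ℂ :=
  toComplex (γ t) + (2 * Complex.I) * (q.1 • moment γ φ t + q.2 • moment γ ψ t) -
    ((q.1 ^ 2) • moment γ (fun τ => φ τ ^ 2) t + (2 * q.1 * q.2) • moment γ (fun τ => φ τ * ψ τ) t +
      (q.2 ^ 2) • moment γ (fun τ => ψ τ ^ 2) t)

/-- With the square expanded into moments, `bend` at fixed `t` is a polynomial in the two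
parameters. -/
theorem contDiff_bend (γ : ℝ → Plane) (φ ψ : ℝ → ℝ) (t : ℝ) {n : WithTop ℕ∞} :
    ContDiff ℝ n fun q => bend γ φ ψ q t := by
  unfold bend
  fun_prop

section Bend

variable {γ : ℝ → Plane} (hγ : ContDiffOn ℝ ∞ γ (Icc 0 1))
include hγ

theorem smooth_toComplex_vel : ContDiffOn ℝ ∞ (fun t => toComplex (vel γ t)) (Icc 0 1) :=
  toComplexCLM.contDiff.comp_contDiffOn (smooth_vel hγ)

theorem smooth_toComplex : ContDiffOn ℝ ∞ (fun t => toComplex (γ t)) (Icc 0 1) :=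
  toComplexCLM.contDiff.comp_contDiffOn hγ

theorem hasDerivWithinAt_toComplex {t : ℝ} (ht : t ∈ Icc (0 : ℝ) 1) :
    HasDerivWithinAt (fun t => toComplex (γ t)) (toComplex (vel γ t)) (Icc 0 1) t :=
  toComplexCLM.hasFDerivAt.comp_hasDerivWithinAt t (hasDerivWithinAt_of_smooth hγ ht)

theorem smooth_moment {f : ℝ → ℝ} (hf : ContDiffOn ℝ ∞ f (Icc 0 1)) :
    ContDiffOn ℝ ∞ (moment γ f) (Icc 0 1) :=
  smooth_primitive (hf.smul (smooth_toComplex_vel hγ))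

theorem hasDerivWithinAt_moment {f : ℝ → ℝ} (hf : ContDiffOn ℝ ∞ f (Icc 0 1)) {t : ℝ}
    (ht : t ∈ Icc (0 : ℝ) 1) :
    HasDerivWithinAt (moment γ f) (f t • toComplex (vel γ t)) (Icc 0 1) t :=
  hasDerivWithinAt_primitive (hf.smul (smooth_toComplex_vel hγ)).continuousOn ht

theorem moment_im {f : ℝ → ℝ} (hf : ContDiffOn ℝ ∞ f (Icc 0 1)) :
    (moment γ f 1).im = ∫ t in (0 : ℝ)..1, f t * vel γ t 1 := by
  have hi : IntervalIntegrable (fun t => f t • toComplex (vel γ t)) volume 0 1 :=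
    (hf.smul (smooth_toComplex_vel hγ)).continuousOn.intervalIntegrable_of_Icc zero_le_one
  have := Complex.imCLM.intervalIntegral_comp_comm hi
  simp only [Complex.imCLM_apply] at this
  rw [moment, ← this]
  refine intervalIntegral.integral_congr fun t _ => ?_
  simp [toComplex]

variable {φ ψ : ℝ → ℝ} (hφ : ContDiffOn ℝ ∞ φ (Icc 0 1)) (hψ : ContDiffOn ℝ ∞ ψ (Icc 0 1))
include hφ hψ

theorem hasDerivWithinAt_bend (q : ℝ × ℝ) {t : ℝ} (ht : t ∈ Icc (0 : ℝ) 1) :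
    HasDerivWithinAt (bend γ φ ψ q)
      ((1 + (q.1 * φ t + q.2 * ψ t : ℝ) * Complex.I) ^ 2 * toComplex (vel γ t)) (Icc 0 1) t := by
  have hm := fun {f : ℝ → ℝ} (hf : ContDiffOn ℝ ∞ f (Icc 0 1)) =>
    hasDerivWithinAt_moment hγ hf ht
  refine (((hasDerivWithinAt_toComplex hγ ht).add
    ((((hm hφ).const_smul q.1).add ((hm hψ).const_smul q.2)).const_mul (2 * Complex.I))).sub
    ((((hm (hφ.pow 2)).const_smul (q.1 ^ 2)).add ((hm (hφ.mul hψ)).const_smul (2 * q.1 * q.2))).add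
      ((hm (hψ.pow 2)).const_smul (q.2 ^ 2)))).congr_deriv ?_
  simp only [Complex.real_smul]
  push_cast
  linear_combination (-(q.1 * φ t + q.2 * ψ t : ℂ) ^ 2 * toComplex (vel γ t)) * Complex.I_sq

theorem smooth_bend {s : ℝ → ℝ} {ε₀ : ℝ} (hs : ContDiffOn ℝ ∞ s (Ioo (-ε₀) ε₀)) :
    ContDiffOn ℝ ∞ (fun q : ℝ × ℝ => bend γ φ ψ (q.1, s q.1) q.2) (strip ε₀) := by
  have h1 : ContDiffOn ℝ ∞ (fun q : ℝ × ℝ => q.1) (strip ε₀) := contDiffOn_fst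
  have hs1 : ContDiffOn ℝ ∞ (fun q : ℝ × ℝ => s q.1) (strip ε₀) :=
    hs.comp contDiffOn_fst fun q hq => hq.1
  have h2 : ∀ {g : ℝ → ℂ}, ContDiffOn ℝ ∞ g (Icc 0 1) →
      ContDiffOn ℝ ∞ (fun q : ℝ × ℝ => g q.2) (strip ε₀) := fun hg =>
    hg.comp contDiffOn_snd fun q hq => hq.2
  have hm := fun {f : ℝ → ℝ} (hf : ContDiffOn ℝ ∞ f (Icc 0 1)) => h2 (smooth_moment hγ hf)
  exact ((h2 (smooth_toComplex hγ)).add (contDiffOn_const.mul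
    ((h1.smul (hm hφ)).add (hs1.smul (hm hψ))))).sub
    ((((h1.pow 2).smul (hm (hφ.pow 2))).add
      (((contDiffOn_const.mul h1).mul hs1).smul (hm (hφ.mul hψ)))).add
      ((hs1.pow 2).smul (hm (hψ.pow 2))))

end Bend

theorem hasDerivAt_bend (γ : ℝ → Plane) (φ ψ : ℝ → ℝ) {s : ℝ → ℝ} {s' : ℝ}
    (hs0 : s 0 = 0) (hs : HasDerivAt s s' 0) (t : ℝ) :
    HasDerivAt (fun ε => bend γ φ ψ (ε, s ε) t)
      ((2 * Complex.I) * (moment γ φ t + s' • moment γ ψ t)) 0 := by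
  have hid := hasDerivAt_id (0 : ℝ)
  refine ((((hid.smul_const (moment γ φ t)).add (hs.smul_const (moment γ ψ t))).const_mul
    (2 * Complex.I)).const_add (toComplex (γ t)) |>.sub
    ((((hid.pow 2).smul_const (moment γ (fun τ => φ τ ^ 2) t)).add
      (((hid.const_mul 2).mul hs).smul_const (moment γ (fun τ => φ τ * ψ τ) t))).add
      ((hs.pow 2).smul_const (moment γ (fun τ => ψ τ ^ 2) t)))).congr_deriv ?_
  simp [hs0]

section

theorem bend_apply_zero (γ : ℝ → Plane) (φ ψ : ℝ → ℝ) (q : ℝ × ℝ) :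
    bend γ φ ψ q 0 = toComplex (γ 0) := by
  simp [bend, moment_zero]

theorem bend_zero (γ : ℝ → Plane) (φ ψ : ℝ → ℝ) (t : ℝ) :
    bend γ φ ψ (0, 0) t = toComplex (γ t) := by
  simp [bend]

/-- Lets `hasDerivAt_bend`, stated along the first parameter, also give the derivative in the
second. -/
theorem bend_swap (γ : ℝ → Plane) (φ ψ : ℝ → ℝ) (a b : ℝ) (t : ℝ) :
    bend γ φ ψ (a, b) t = bend γ ψ φ (b, a) t := by
  simp only [bend, mul_comm (φ _), mul_right_comm 2 a b]
  ring

/-- The reason for bending by a square: the speed factor has no square root, so the length is a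
quadratic polynomial in the parameters, without linear terms. -/
theorem norm_one_add_mul_I_sq (σ : ℝ) : ‖(1 + σ * Complex.I) ^ 2‖ = 1 + σ ^ 2 := by
  rw [norm_pow, ← Complex.normSq_eq_norm_sq, Complex.normSq_apply]
  simp
  ring

/-- The length of the curve `bend γ φ ψ q`, when `γ` has length `L`. -/
noncomputable def bendLength (L : ℝ) (γ : ℝ → Plane) (φ ψ : ℝ → ℝ) (q : ℝ × ℝ) : ℝ :=
  L + (q.1 ^ 2 * (∫ t in (0 : ℝ)..1, φ t ^ 2 * ‖vel γ t‖) +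
    2 * q.1 * q.2 * (∫ t in (0 : ℝ)..1, φ t * ψ t * ‖vel γ t‖) +
      q.2 ^ 2 * (∫ t in (0 : ℝ)..1, ψ t ^ 2 * ‖vel γ t‖))

variable {l L : ℝ} {γ : ℝ → Plane} {φ ψ : ℝ → ℝ}

theorem integral_bend_speed (h : IsAdmissible l L γ) (hφ : ContDiffOn ℝ ∞ φ (Icc 0 1))
    (hψ : ContDiffOn ℝ ∞ ψ (Icc 0 1)) (q : ℝ × ℝ) :
    ∫ t in (0 : ℝ)..1, (1 + (q.1 * φ t + q.2 * ψ t) ^ 2) * ‖vel γ t‖ = bendLength L γ φ ψ q := by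
  have hn := h.smooth_speed.continuousOn
  have hi : ∀ {f : ℝ → ℝ}, ContinuousOn f (Icc 0 1) →
      IntervalIntegrable (fun t => f t * ‖vel γ t‖) volume 0 1 := fun hf =>
    (hf.mul hn).intervalIntegrable_of_Icc zero_le_one
  have h1 : IntervalIntegrable (fun t => ‖vel γ t‖) volume 0 1 :=
    hn.intervalIntegrable_of_Icc zero_le_one
  have h2 : IntervalIntegrable (fun t => φ t ^ 2 * ‖vel γ t‖) volume 0 1 :=
    hi (hφ.pow 2).continuousOn
  have h3 : IntervalIntegrable (fun t => φ t * ψ t * ‖vel γ t‖) volume 0 1 :=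
    hi (hφ.mul hψ).continuousOn
  have h4 : IntervalIntegrable (fun t => ψ t ^ 2 * ‖vel γ t‖) volume 0 1 :=
    hi (hψ.pow 2).continuousOn
  rw [bendLength, ← h.length_eq, length, arcLength, ← intervalIntegral.integral_const_mul,
    ← intervalIntegral.integral_const_mul, ← intervalIntegral.integral_const_mul,
    ← intervalIntegral.integral_add (h2.const_mul _) (h3.const_mul _),
    ← intervalIntegral.integral_add ((h2.const_mul _).add (h3.const_mul _)) (h4.const_mul _),
    ← intervalIntegral.integral_add h1 (((h2.const_mul _).add (h3.const_mul _)).add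
      (h4.const_mul _))]
  refine intervalIntegral.integral_congr fun t _ => ?_
  ring

theorem smooth_bend_slice (hγ : ContDiffOn ℝ ∞ γ (Icc 0 1)) (hφ : ContDiffOn ℝ ∞ φ (Icc 0 1))
    (hψ : ContDiffOn ℝ ∞ ψ (Icc 0 1)) (q : ℝ × ℝ) :
    ContDiffOn ℝ ∞ (bend γ φ ψ q) (Icc 0 1) := by
  have hm := fun {f : ℝ → ℝ} (hf : ContDiffOn ℝ ∞ f (Icc 0 1)) => smooth_moment hγ hf
  exact ((smooth_toComplex hγ).add (contDiffOn_const.mul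
    (((hm hφ).const_smul q.1).add ((hm hψ).const_smul q.2)))).sub
    ((((hm (hφ.pow 2)).const_smul (q.1 ^ 2)).add ((hm (hφ.mul hψ)).const_smul (2 * q.1 * q.2))).add
      ((hm (hψ.pow 2)).const_smul (q.2 ^ 2)))

/-- The bent curve, rotated and scaled so that it ends at `(l, 0)`. -/
noncomputable def bentCurve (l : ℝ) (γ : ℝ → Plane) (φ ψ : ℝ → ℝ) (q : ℝ × ℝ) (t : ℝ) : Plane :=
  toPlane ((l : ℂ) / bend γ φ ψ q 1 * bend γ φ ψ q t)

theorem IsAdmissible.toComplex_start (h : IsAdmissible l L γ) : toComplex (γ 0) = 0 := by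
  rw [h.start]; apply Complex.ext <;> simp [toComplex]

theorem IsAdmissible.toComplex_finish (h : IsAdmissible l L γ) : toComplex (γ 1) = l := by
  rw [h.finish]; apply Complex.ext <;> simp [toComplex]

theorem norm_vel_bentCurve (hl : 0 < l) (hγ : ContDiffOn ℝ ∞ γ (Icc 0 1))
    (hφ : ContDiffOn ℝ ∞ φ (Icc 0 1)) (hψ : ContDiffOn ℝ ∞ ψ (Icc 0 1)) (q : ℝ × ℝ) {t : ℝ}
    (ht : t ∈ Icc (0 : ℝ) 1) :
    ‖vel (bentCurve l γ φ ψ q) t‖ =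
      l / ‖bend γ φ ψ q 1‖ * ((1 + (q.1 * φ t + q.2 * ψ t) ^ 2) * ‖vel γ t‖) := by
  have h1 := toPlaneCLM.hasFDerivAt.comp_hasDerivWithinAt t
    ((hasDerivWithinAt_bend hγ hφ hψ q ht).const_mul ((l : ℂ) / bend γ φ ψ q 1))
  have h2 : vel (bentCurve l γ φ ψ q) t = _ := h1.derivWithin (uniqueDiffOn_unitInterval t ht)
  rw [h2, toPlaneCLM_apply, norm_toPlane, norm_mul, norm_mul, norm_one_add_mul_I_sq,
    norm_toComplex, norm_div, Complex.norm_real, Real.norm_of_nonneg hl.le]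

/-- The similarity scales length by `l / |b|`, with `b` the bent end point, so length `L` means `l *
bendLength = L * |b|`. Hypothesis `hq` is the square of this, which stays polynomial; positivity
undoes the squaring. -/
theorem isAdmissible_bentCurve (h : IsAdmissible l L γ) (hl : 0 < l) (hL : 0 < L)
    (hφ : ContDiffOn ℝ ∞ φ (Icc 0 1)) (hψ : ContDiffOn ℝ ∞ ψ (Icc 0 1)) {q : ℝ × ℝ}
    (hbne : bend γ φ ψ q 1 ≠ 0) (hlen : 0 < bendLength L γ φ ψ q)
    (hq : L ^ 2 * ((bend γ φ ψ q 1).re ^ 2 + (bend γ φ ψ q 1).im ^ 2) -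
      l ^ 2 * bendLength L γ φ ψ q ^ 2 = 0) :
    IsAdmissible l L (bentCurve l γ φ ψ q) := by
  have hbpos : 0 < ‖bend γ φ ψ q 1‖ := norm_pos_iff.2 hbne
  refine ⟨toPlaneCLM.contDiff.comp_contDiffOn
    (contDiffOn_const.mul (smooth_bend_slice h.smooth hφ hψ q)), ?_, ?_, ?_, fun t ht => ?_⟩
  · rw [bentCurve, bend_apply_zero, h.toComplex_start, mul_zero]
    simp [toPlane]
  · rw [bentCurve, div_mul_cancel₀ _ hbne]
    simp [toPlane]
  · have : length (bentCurve l γ φ ψ q) = ∫ t in (0 : ℝ)..1,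
        l / ‖bend γ φ ψ q 1‖ * ((1 + (q.1 * φ t + q.2 * ψ t) ^ 2) * ‖vel γ t‖) := by
      refine intervalIntegral.integral_congr fun t ht => ?_
      rw [uIcc_of_le zero_le_one] at ht
      exact norm_vel_bentCurve hl h.smooth hφ hψ q ht
    rw [this, intervalIntegral.integral_const_mul,
      integral_bend_speed h hφ hψ q, div_mul_eq_mul_div, div_eq_iff hbpos.ne']
    have hsq : (l * bendLength L γ φ ψ q) ^ 2 = (L * ‖bend γ φ ψ q 1‖) ^ 2 := by
      rw [mul_pow, mul_pow, ← Complex.normSq_eq_norm_sq, Complex.normSq_apply]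
      linarith
    exact (sq_eq_sq₀ (by positivity) (by positivity)).1 hsq
  · rw [← norm_pos_iff, norm_vel_bentCurve hl h.smooth hφ hψ q ht]
    have := h.speed_pos ht
    positivity

/-- Every admissible curve has a variation whose first order part is given by the angle function
`φ`, corrected by a multiple of `ψ`, up to an infinitesimal similarity. -/
theorem exists_variation (h : IsAdmissible l L γ) (hl : 0 < l) (hL : 0 < L)
    (hφ : ContDiffOn ℝ ∞ φ (Icc 0 1)) (hψ : ContDiffOn ℝ ∞ ψ (Icc 0 1))
    (hne : ∫ t in (0 : ℝ)..1, ψ t * vel γ t 1 ≠ 0) :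
    ∃ (s' : ℝ) (c' : ℂ) (ε₀ : ℝ) (Γ : ℝ → ℝ → Plane), IsVariation l L γ ε₀ Γ ∧
      c' * l + 2 * Complex.I * (moment γ φ 1 + s' • moment γ ψ 1) = 0 ∧
      ∀ t ∈ Icc (0 : ℝ) 1, HasDerivAt (fun ε => toComplex (Γ ε t))
        (c' * toComplex (γ t) + 2 * Complex.I * (moment γ φ t + s' • moment γ ψ t)) 0 := by
  have hend := h.toComplex_finish
  set b : ℝ × ℝ → ℂ := fun q => bend γ φ ψ q 1 with hb
  have hb0 : b (0, 0) = l := (bend_zero γ φ ψ 1).trans hend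
  have hbs : ∀ {n : WithTop ℕ∞}, ContDiff ℝ n b := contDiff_bend γ φ ψ 1
  have hls : ∀ {n : WithTop ℕ∞}, ContDiff ℝ n (bendLength L γ φ ψ) := by
    intro n; unfold bendLength; fun_prop
  set G : ℝ × ℝ → ℝ := fun q => L ^ 2 * ((b q).re ^ 2 + (b q).im ^ 2) -
    l ^ 2 * bendLength L γ φ ψ q ^ 2 with hGdef
  have hG : ContDiff ℝ ω G :=
    (contDiff_const.mul (((Complex.reCLM.contDiff.comp hbs).pow 2).add
      ((Complex.imCLM.contDiff.comp hbs).pow 2))).sub (contDiff_const.mul (hls.pow 2))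
  have hG0 : G (0, 0) = 0 := by
    simp only [hGdef, hb0, bendLength]; simp; ring
  -- The length is stationary at `0`, so only `|b|²` contributes: `2 l Re (2i m) = -4 l Im m`, where
  -- `m` is the moment of `ψ`.
  have hd : HasDerivAt (fun s => G (0, s)) (-(4 * l * L ^ 2) * (moment γ ψ 1).im) 0 := by
    have h1 : HasDerivAt (fun s => b (0, s)) (2 * Complex.I * moment γ ψ 1) 0 := by
      simp only [hb, bend_swap γ φ ψ 0]
      have := hasDerivAt_bend γ ψ φ (s := fun _ => 0) rfl (hasDerivAt_const (0 : ℝ) (0 : ℝ)) 1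
      simpa using this
    have h2 : HasDerivAt (fun s => bendLength L γ φ ψ (0, s)) 0 0 := by
      have := ((hasDerivAt_pow 2 (0 : ℝ)).mul_const
        (∫ t in (0 : ℝ)..1, ψ t ^ 2 * ‖vel γ t‖)).const_add L
      simpa [bendLength] using this
    have hre : HasDerivAt (fun s => (b (0, s)).re) _ 0 :=
      Complex.reCLM.hasFDerivAt.comp_hasDerivAt (0 : ℝ) h1
    have him : HasDerivAt (fun s => (b (0, s)).im) _ 0 :=
      Complex.imCLM.hasFDerivAt.comp_hasDerivAt (0 : ℝ) h1
    refine ((((hre.pow 2).add (him.pow 2)).const_mul (L ^ 2)).sub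
      ((h2.pow 2).const_mul (l ^ 2))).congr_deriv ?_
    simp [hb0]; ring
  have hd0 : -(4 * l * L ^ 2) * (moment γ ψ 1).im ≠ 0 := by
    rw [moment_im h.smooth hψ]
    exact mul_ne_zero (by simp [hl.ne', hL.ne']) hne
  have hU : {q | b q ≠ 0 ∧ 0 < bendLength L γ φ ψ q} ∈ nhds ((0 : ℝ), (0 : ℝ)) := by
    have hbc : Continuous b := (hbs (n := 0)).continuous
    have hlc : Continuous (bendLength L γ φ ψ) := (hls (n := 0)).continuous
    refine ((isOpen_ne.preimage hbc).inter (isOpen_Ioi.preimage hlc)).mem_nhds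
      ⟨?_, ?_⟩
    · simp [hb0, hl.ne']
    · simpa [bendLength] using hL
  obtain ⟨ε₀, s, hε₀, hs0, hs, hsG⟩ := exists_smooth_implicit hG hG0 hd hd0 hU
  have h0 : (0 : ℝ) ∈ Ioo (-ε₀) ε₀ := ⟨by linarith, hε₀⟩
  set Γ : ℝ → ℝ → Plane := fun ε => bentCurve l γ φ ψ (ε, s ε) with hΓ
  have hbs2 : ContDiffOn ℝ ∞ (fun q : ℝ × ℝ => b (q.1, s q.1)) (strip ε₀) :=
    hbs.comp_contDiffOn (contDiffOn_fst.prodMk (hs.comp contDiffOn_fst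
      (show MapsTo Prod.fst (strip ε₀) (Ioo (-ε₀) ε₀) from fun q hq => hq.1)))
  have hsmooth : ContDiffOn ℝ ∞ (Function.uncurry Γ) (strip ε₀) := by
    have h1 : ContDiffOn ℝ ∞ (fun q : ℝ × ℝ => (l : ℂ) / b (q.1, s q.1)) (strip ε₀) := by
      simp only [div_eq_mul_inv]
      exact contDiffOn_const.mul (hbs2.inv fun q hq => (hsG q.1 hq.1).2.1)
    exact toPlaneCLM.contDiff.comp_contDiffOn (h1.mul (smooth_bend h.smooth hφ hψ hs))
  have hvar : IsVariation l L γ ε₀ Γ := by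
    refine ⟨hε₀, hsmooth, fun ε hε => ?_, fun t _ => ?_⟩
    · obtain ⟨hGz, hbne, hlpos⟩ := hsG ε hε
      exact isAdmissible_bentCurve h hl hL hφ hψ hbne hlpos hGz
    · have hb1 : bend γ φ ψ (0, 0) 1 = l := hb0
      simp only [hΓ, bentCurve, hs0, bend_zero, hend]
      rw [div_self (by exact_mod_cast hl.ne'), one_mul, toPlane_toComplex]
  have hs' : HasDerivAt s (deriv s 0) 0 :=
    ((hs.differentiableOn (by simp) 0 h0).differentiableAt (Ioo_mem_nhds h0.1 h0.2)).hasDerivAt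
  have hlC : (l : ℂ) ≠ 0 := by exact_mod_cast hl.ne'
  set W : ℝ → ℂ := fun t => 2 * Complex.I * (moment γ φ t + deriv s 0 • moment γ ψ t) with hW
  -- The second witness is the derivative of the similarity factor `l / b` at `ε = 0`, where `b =
  -- l`.
  refine ⟨deriv s 0, -(W 1 / l), ε₀, Γ, hvar, ?_, fun t _ => ?_⟩
  · rw [neg_mul, div_mul_cancel₀ _ hlC]
    simp [hW]
  · have hbd : ∀ t, HasDerivAt (fun ε => bend γ φ ψ (ε, s ε) t) (W t) 0 :=
      hasDerivAt_bend γ φ ψ hs0 hs'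
    have hcoe : ∀ ε, toComplex (Γ ε t) = (l : ℂ) / b (ε, s ε) * bend γ φ ψ (ε, s ε) t :=
      fun ε => rfl
    simp only [hcoe]
    refine ((((hasDerivAt_const (0 : ℝ) (l : ℂ)).div (hbd 1)
      (by rw [hs0]; exact hb0.trans_ne hlC)).mul (hbd t))).congr_deriv ?_
    have hb1 : bend γ φ ψ (0, 0) 1 = l := hb0
    simp only [Pi.div_apply, hs0, bend_zero, hb1]
    field_simp
    ring

end

/-! ### Necessity: the Euler–Lagrange equation of a critical curve -/

section

variable {l L : ℝ} {γ : ℝ → Plane}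

theorem IsAdmissible.integral_vel_zero (h : IsAdmissible l L γ) :
    ∫ t in (0 : ℝ)..1, vel γ t 0 = l := by
  rw [integral_eq_sub_of_hasDerivWithinAt (fun t ht => hasDerivWithinAt_curve_coord h.smooth ht 0)
    (smooth_coord (smooth_vel h.smooth) 0).continuousOn (right_mem_Icc.2 zero_le_one), h.start,
    h.finish]
  simp

/-- A curve longer than the distance of its end points is not horizontal. -/
theorem IsAdmissible.not_horizontal (h : IsAdmissible l L γ) (hl : 0 < l) (hlL : l < L) :
    ¬ ∀ t ∈ Icc (0 : ℝ) 1, vel γ t 1 = 0 := by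
  intro H
  set ξ := vel γ 0 0 / ‖vel γ 0‖ with hξ
  have hm0 : (0 : ℝ) ∈ Icc (0 : ℝ) 1 := left_mem_Icc.2 zero_le_one
  have hconst : ∀ t ∈ Icc (0 : ℝ) 1, vel γ t 0 = ξ * ‖vel γ t‖ := by
    intro t ht
    have := eq_of_hasDerivWithinAt_zero (f := fun t => vel γ t 0 / ‖vel γ t‖) (fun t ht => by
      simpa [H t ht] using h.hasDerivWithinAt_tangent_zero ht) ht
    rwa [div_eq_iff (h.speed_pos ht).ne'] at this
  have hξ2 : ξ ^ 2 = 1 := by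
    have h1 := plane_norm_sq (vel γ 0)
    rw [H 0 hm0] at h1
    rw [hξ, div_pow, h1]
    have := h.speed_pos hm0
    rw [zero_pow two_ne_zero, add_zero]
    refine div_self ?_
    rw [zero_pow two_ne_zero, add_zero] at h1
    rw [← h1]; positivity
  have hlen : l = ξ * L := by
    rw [← h.integral_vel_zero, ← h.length_eq, length, arcLength,
      ← intervalIntegral.integral_const_mul]
    refine intervalIntegral.integral_congr fun t ht => ?_
    rw [uIcc_of_le zero_le_one] at ht
    exact hconst t ht
  have : l ^ 2 = L ^ 2 := by rw [hlen, mul_pow, hξ2, one_mul]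
  nlinarith

/-- Critical pinned curves satisfy `κ = -lam y`. -/
theorem exists_curvature_eq (hcrit : IsCriticalPoint l L γ) (hl : 0 < l) (hlL : l < L) :
    ∃ lam : ℝ, ∀ t ∈ Icc (0 : ℝ) 1, curvature γ t = -lam * γ t 1 := by
  obtain ⟨h, hcr⟩ := hcrit
  have hm0 : (0 : ℝ) ∈ Icc (0 : ℝ) 1 := left_mem_Icc.2 zero_le_one
  have hm1 : (1 : ℝ) ∈ Icc (0 : ℝ) 1 := right_mem_Icc.2 zero_le_one
  have hψ : ContDiffOn ℝ ∞ (fun t => vel γ t 1) (Icc 0 1) := smooth_coord (smooth_vel h.smooth) 1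
  have hy : ContDiffOn ℝ ∞ (fun t => γ t 1) (Icc 0 1) := smooth_coord h.smooth 1
  have hκ := h.smooth_curvature
  have hψ' : ContDiffOn ℝ ∞ (fun t => acc γ t 1) (Icc 0 1) := smooth_coord (smooth_acc h.smooth) 1
  set N := ∫ t in (0 : ℝ)..1, vel γ t 1 * vel γ t 1 with hN
  have hN0 : N ≠ 0 := fun hN0 => h.not_horizontal hl hlL fun t ht => by
    simpa using eq_zero_of_integral_eq_zero (hψ.mul hψ).continuousOn
      (fun t _ => mul_self_nonneg _) hN0 t ht
  set m := ∫ t in (0 : ℝ)..1, curvature γ t * acc γ t 1 with hm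
  -- `N` weights the correction `s'` in the linearized constraint and `m` in the energy; this
  -- quotient makes `s'` cancel when the two are combined.
  set lam := m / N with hlam
  have hmN : m = lam * N := (div_mul_cancel₀ _ hN0).symm
  set g : ℝ → ℝ := fun t => curvature γ t + lam * γ t 1 with hg
  have hgs : ContDiffOn ℝ ∞ g (Icc 0 1) := hκ.add (contDiffOn_const.mul hy)
  -- Test with the angle whose derivative is the defect `g` of the desired equation.
  set φ : ℝ → ℝ := fun T => ∫ t in (0 : ℝ)..T, g t with hφdef
  have hφ : ContDiffOn ℝ ∞ φ (Icc 0 1) := smooth_primitive hgs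
  have hφ' : ∀ t ∈ Icc (0 : ℝ) 1, HasDerivWithinAt φ (g t) (Icc 0 1) t := fun t ht =>
    hasDerivWithinAt_primitive hgs.continuousOn ht
  obtain ⟨s', c', ε₀, Γ, hΓ, hc', hder⟩ :=
    exists_variation h hl (hl.trans hlL) hφ hψ hN0
  obtain ⟨P, Q, α, β, Θ', hP, hQ, hP', hQ', -, -, hΘ, -, hlen, hE⟩ := hΓ.first_variation
  set Φ : ℝ → ℝ := fun t => φ t + s' * vel γ t 1 with hΦ
  set Z : ℝ → ℂ := fun t => c' * toComplex (γ t) +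
    2 * Complex.I * (moment γ φ t + s' • moment γ (fun t => vel γ t 1) t) with hZ
  have hZ' : ∀ t ∈ Icc (0 : ℝ) 1, HasDerivWithinAt Z
      ((c' + 2 * Complex.I * Φ t) * toComplex (vel γ t)) (Icc 0 1) t := fun t ht => by
    refine (((hasDerivWithinAt_toComplex h.smooth ht).const_mul c').add
      (((hasDerivWithinAt_moment h.smooth hφ ht).add
      ((hasDerivWithinAt_moment h.smooth hψ ht).const_smul s')).const_mul
        (2 * Complex.I))).congr_deriv ?_
    simp only [Complex.real_smul, hΦ]
    push_cast
    ring
  have hPZ : ∀ t ∈ Icc (0 : ℝ) 1, P t = (Z t).re := fun t ht =>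
    (hP t ht).unique (Complex.reCLM.hasFDerivAt.comp_hasDerivAt (0 : ℝ) (hder t ht))
  have hQZ : ∀ t ∈ Icc (0 : ℝ) 1, Q t = (Z t).im := fun t ht =>
    (hQ t ht).unique (Complex.imCLM.hasFDerivAt.comp_hasDerivAt (0 : ℝ) (hder t ht))
  have hα : ∀ t ∈ Icc (0 : ℝ) 1, α t =
      c'.re * vel γ t 0 - (c'.im + 2 * Φ t) * vel γ t 1 := fun t ht => by
    have h1 := (uniqueDiffOn_unitInterval t ht).eq_deriv _ (hP' t ht)
      (HasDerivWithinAt.congr (Complex.reCLM.hasFDerivAt.comp_hasDerivWithinAt t (hZ' t ht))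
        hPZ (hPZ t ht))
    rw [h1]
    simp [toComplex]
  have hβ : ∀ t ∈ Icc (0 : ℝ) 1, β t =
      c'.re * vel γ t 1 + (c'.im + 2 * Φ t) * vel γ t 0 := fun t ht => by
    have h1 := (uniqueDiffOn_unitInterval t ht).eq_deriv _ (hQ' t ht)
      (HasDerivWithinAt.congr (Complex.imCLM.hasFDerivAt.comp_hasDerivWithinAt t (hZ' t ht))
        hQZ (hQZ t ht))
    rw [h1]
    simp [toComplex]
  have hspeed : ∀ t ∈ Icc (0 : ℝ) 1,
      (vel γ t 0 * α t + vel γ t 1 * β t) / ‖vel γ t‖ = c'.re * ‖vel γ t‖ := fun t ht => by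
    rw [div_eq_iff (h.speed_pos ht).ne', hα t ht, hβ t ht, mul_assoc, ← sq, plane_norm_sq]
    ring
  -- The infinitesimal similarity cannot dilate: the speed varies by the constant factor `c'.re`,
  -- while the length is fixed.
  have hr : c'.re = 0 := by
    have : c'.re * L = 0 := by
      rw [← hlen, ← h.length_eq, length, arcLength, ← intervalIntegral.integral_const_mul]
      refine intervalIntegral.integral_congr fun t ht => ?_
      rw [uIcc_of_le zero_le_one] at ht
      exact (hspeed t ht).symm
    exact (mul_eq_zero.1 this).resolve_right (hl.trans hlL).ne'
  have hconstr : (∫ t in (0 : ℝ)..1, φ t * vel γ t 1) + s' * N = 0 := by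
    have h1 := congrArg Complex.re hc'
    rw [hN, ← moment_im h.smooth hφ, ← moment_im h.smooth hψ]
    simp [hr] at h1
    linarith
  have hΘ' : ∀ t ∈ Icc (0 : ℝ) 1, Θ' t = 2 * (g t + s' * acc γ t 1) := fun t ht => by
    have hform : ∀ τ ∈ Icc (0 : ℝ) 1, (vel γ τ 0 * β τ - vel γ τ 1 * α τ) / ‖vel γ τ‖ ^ 2 =
        c'.im + 2 * (φ τ + s' * vel γ τ 1) := fun τ hτ => by
      rw [div_eq_iff (pow_pos (h.speed_pos hτ) 2).ne', hα τ hτ, hβ τ hτ, plane_norm_sq]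
      ring
    exact (uniqueDiffOn_unitInterval t ht).eq_deriv _ (hΘ t ht)
      (((((hφ' t ht).add ((hasDerivWithinAt_vel_coord h.smooth ht 1).const_mul s')).const_mul
        2).const_add c'.im).congr hform (hform t ht))
  have hi : ∀ {f : ℝ → ℝ}, ContDiffOn ℝ ∞ f (Icc 0 1) → IntervalIntegrable f volume 0 1 :=
    fun hf => hf.continuousOn.intervalIntegrable_of_Icc zero_le_one
  have hE0 : (∫ t in (0 : ℝ)..1, curvature γ t * g t) + s' * m = 0 := by
    have h1 := hE.unique (hcr ε₀ Γ hΓ)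
    have h2 : ∫ t in (0 : ℝ)..1, (2 * curvature γ t * Θ' t - curvature γ t ^ 2 *
          ((vel γ t 0 * α t + vel γ t 1 * β t) / ‖vel γ t‖)) =
        ∫ t in (0 : ℝ)..1, 4 * (curvature γ t * g t + s' * (curvature γ t * acc γ t 1)) := by
      refine intervalIntegral.integral_congr fun t ht => ?_
      rw [uIcc_of_le zero_le_one] at ht
      simp only
      rw [hspeed t ht, hΘ' t ht, hr]
      ring
    rw [h2, intervalIntegral.integral_const_mul, intervalIntegral.integral_add (hi (hκ.mul hgs))
      ((hi (hκ.mul hψ')).const_mul s'), intervalIntegral.integral_const_mul] at h1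
    linarith
  -- The boundary terms vanish because both end points lie on the axis.
  have hparts : (∫ t in (0 : ℝ)..1, φ t * vel γ t 1) = -∫ t in (0 : ℝ)..1, g t * γ t 1 := by
    have h1 := integral_eq_sub_of_hasDerivWithinAt (f := fun t => φ t * γ t 1)
      (fun t ht => (hφ' t ht).mul (hasDerivWithinAt_curve_coord h.smooth ht 1))
      ((hgs.mul hy).add (hφ.mul hψ)).continuousOn hm1
    rw [intervalIntegral.integral_add (hi (hgs.mul hy)) (hi (hφ.mul hψ)), h.start, h.finish] at h1
    simp at h1
    linarith
  have hsq : ∫ t in (0 : ℝ)..1, g t * g t = 0 := by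
    have h1 : ∫ t in (0 : ℝ)..1, g t * g t =
        ∫ t in (0 : ℝ)..1, (curvature γ t * g t + lam * (g t * γ t 1)) :=
      intervalIntegral.integral_congr fun t _ => by simp only [hg]; ring
    rw [h1, intervalIntegral.integral_add (hi (hκ.mul hgs)) ((hi (hgs.mul hy)).const_mul lam),
      intervalIntegral.integral_const_mul]
    rw [hparts] at hconstr
    rw [hmN] at hE0
    linear_combination hE0 - lam * hconstr
  refine ⟨lam, fun t ht => ?_⟩
  have := eq_zero_of_integral_eq_zero (hgs.mul hgs).continuousOn
    (fun t _ => mul_self_nonneg _) hsq t ht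
  have h0 : g t = 0 := by simpa using this
  simp only [hg] at h0
  linarith

end

/-! ### The explicit elastica -/

section Profile

variable (ν p : ℝ)

/-- The amplitude along the curve of angular frequency `ν`. -/
noncomputable def profAm (s : ℝ) : ℝ := jacobiAm (ν * s + ellipticK p) p

/-- Horizontal coordinate of the explicit elastica. -/
noncomputable def profX (s : ℝ) : ℝ :=
  2 * p ^ 2 * (∫ t in (0 : ℝ)..s, jacobiCn (ν * t + ellipticK p) p ^ 2) + (1 - 2 * p ^ 2) * s

/-- Vertical coordinate of the explicit elastica. -/
noncomputable def profY (s : ℝ) : ℝ := -(2 * p / ν) * jacobiCn (ν * s + ellipticK p) p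

/-- Horizontal component of the tangent of the explicit elastica. -/
noncomputable def profXi (s : ℝ) : ℝ := 1 - 2 * p ^ 2 * Real.sin (profAm ν p s) ^ 2

/-- Vertical component of the tangent of the explicit elastica. -/
noncomputable def profEta (s : ℝ) : ℝ :=
  2 * p * Real.sin (profAm ν p s) * √(1 - p ^ 2 * Real.sin (profAm ν p s) ^ 2)

variable {ν p} (hp : p ^ 2 < 1)
include hp

theorem hasDerivAt_profAm (s : ℝ) :
    HasDerivAt (profAm ν p) (√(1 - p ^ 2 * Real.sin (profAm ν p s) ^ 2) * ν) s := by
  have h1 : HasDerivAt (fun s => ν * s + ellipticK p) ν s := by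
    simpa using ((hasDerivAt_id s).const_mul ν).add_const (ellipticK p)
  exact (hasDerivAt_jacobiAm hp (ν * s + ellipticK p)).comp s h1

theorem hasDerivAt_profX (s : ℝ) : HasDerivAt (profX ν p) (profXi ν p s) s := by
  have hc : Continuous fun t => jacobiCn (ν * t + ellipticK p) p ^ 2 :=
    (Real.continuous_cos.comp ((continuous_jacobiAm hp).comp (by fun_prop))).pow 2
  have h1 : HasDerivAt (profX ν p) _ s :=
    ((hc.integral_hasStrictDerivAt 0 s).hasDerivAt.const_mul (2 * p ^ 2)).add
      ((hasDerivAt_id s).const_mul (1 - 2 * p ^ 2))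
  refine h1.congr_deriv ?_
  rw [jacobiCn, Real.cos_sq', profXi, profAm]
  ring

theorem hasDerivAt_profY (hν : ν ≠ 0) (s : ℝ) :
    HasDerivAt (profY ν p) (profEta ν p s) s := by
  have h1 : HasDerivAt (profY ν p) _ s :=
    ((hasDerivAt_profAm hp s).cos).const_mul (-(2 * p / ν))
  refine h1.congr_deriv ?_
  rw [profEta]
  field_simp

/-- With `hasDerivAt_profEta`, these are the Frenet equations for curvature `-ν² Y`. -/
theorem hasDerivAt_profXi (hν : ν ≠ 0) (s : ℝ) :
    HasDerivAt (profXi ν p) (ν ^ 2 * profY ν p s * profEta ν p s) s := by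
  have h1 : HasDerivAt (profXi ν p) _ s :=
    (((hasDerivAt_profAm hp s).sin.pow 2).const_mul (2 * p ^ 2)).const_sub 1
  refine h1.congr_deriv ?_
  rw [profEta, profY, jacobiCn, ← profAm]
  field_simp
  norm_num
  left
  ring

theorem hasDerivAt_profEta (hν : ν ≠ 0) (s : ℝ) :
    HasDerivAt (profEta ν p) (-(ν ^ 2 * profY ν p s * profXi ν p s)) s := by
  have hpos := one_sub_mul_sin_sq_pos hp (profAm ν p s)
  have hD := delta_pos hp (profAm ν p s)
  have hDsq := Real.sq_sqrt hpos.le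
  have hsin := (hasDerivAt_profAm (ν := ν) hp s).sin
  have h1 : HasDerivAt (profEta ν p) _ s :=
    (hsin.const_mul (2 * p)).mul
      ((((hsin.pow 2).const_mul (p ^ 2)).const_sub 1).sqrt hpos.ne')
  refine h1.congr_deriv ?_
  rw [profXi, profY, jacobiCn, ← profAm]
  simp only [Pi.pow_apply]
  set S := Real.sin (profAm ν p s)
  set C := Real.cos (profAm ν p s)
  set D := √(1 - p ^ 2 * S ^ 2)
  field_simp
  norm_num
  rw [hDsq]
  ring

omit hp in
theorem profXi_sq_add_profEta_sq (hp : p ^ 2 < 1) (s : ℝ) :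
    profXi ν p s ^ 2 + profEta ν p s ^ 2 = 1 := by
  rw [profXi, profEta, mul_pow, Real.sq_sqrt (one_sub_mul_sin_sq_pos hp _).le]
  ring

theorem profAm_zero : profAm ν p 0 = Real.pi / 2 := by
  rw [profAm, mul_zero, zero_add, jacobiAm_ellipticK hp]

theorem profY_zero : profY ν p 0 = 0 := by
  rw [profY, jacobiCn, ← profAm, profAm_zero hp, Real.cos_pi_div_two, mul_zero]

theorem profXi_zero : profXi ν p 0 = 1 - 2 * p ^ 2 := by
  rw [profXi, profAm_zero hp, Real.sin_pi_div_two]; ring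

theorem profEta_zero : profEta ν p 0 = 2 * p * √(1 - p ^ 2) := by
  rw [profEta, profAm_zero hp, Real.sin_pi_div_two]; simp

/-- The horizontal tangent is `2Δ² - 1` with `Δ = √(1 - p² sin² am)`. Since `am' = νΔ`, the
incomplete integral `E` along the amplitude has derivative `νΔ²`; the constant is fixed at `s = 0`,
where the amplitude is `π/2`. -/
theorem profX_eq (hν : ν ≠ 0) (s : ℝ) : profX ν p s =
    (2 * ellipticEInc p (profAm ν p s) - (ν * s + ellipticK p) -
      (2 * ellipticE p - ellipticK p)) / ν := by
  set g : ℝ → ℝ := fun s => profX ν p s -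
    (2 * ellipticEInc p (profAm ν p s) - (ν * s + ellipticK p) -
      (2 * ellipticE p - ellipticK p)) / ν with hg
  have hder : ∀ s, HasDerivAt g 0 s := fun s => by
    have h1 : HasDerivAt g _ s := (hasDerivAt_profX hp s).sub
      ((((((hasDerivAt_ellipticEInc p _).comp s (hasDerivAt_profAm hp s)).const_mul 2).sub
        (((hasDerivAt_id s).const_mul ν).add_const (ellipticK p))).sub_const
        (2 * ellipticE p - ellipticK p)).div_const ν)
    refine h1.congr_deriv ?_
    have hDsq := Real.sq_sqrt (one_sub_mul_sin_sq_pos hp (profAm ν p s)).le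
    rw [profXi]
    field_simp
    rw [hDsq]
    ring
  have h0 : g s = g 0 := is_const_of_deriv_eq_zero (fun s => (hder s).differentiableAt)
    (fun s => (hder s).deriv) s 0
  have h00 : g 0 = 0 := by
    simp only [hg]
    rw [profAm_zero hp, ← ellipticE_eq]
    simp [profX]
  rw [h00] at h0
  simp only [hg] at h0
  linarith

end Profile

theorem hatX_eq (L p : ℝ) (n : ℕ) (s : ℝ) :
    hatX L p n s = profX (2 * (n + 1) * ellipticK p / L) p s := rfl

theorem two_mul_div_frequency {L p : ℝ} (hp : p ^ 2 < 1) (hL : L ≠ 0) (n : ℕ) :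
    2 * p / (2 * (n + 1) * ellipticK p / L) = p * L / ((n + 1) * ellipticK p) := by
  have := (ellipticK_pos hp).ne'
  have : (n + 1 : ℝ) ≠ 0 := by positivity
  field_simp

theorem hatY_eq {L p : ℝ} (hp : p ^ 2 < 1) (hL : L ≠ 0) (n : ℕ) (s : ℝ) :
    hatY L p n s = profY (2 * (n + 1) * ellipticK p / L) p s := by
  rw [hatY, profY, two_mul_div_frequency hp hL]

theorem checkX_eq {L p : ℝ} (hp : p ^ 2 < 1) (n : ℕ) (s : ℝ) :
    checkX L p n s = -profX (2 * (n + 1) * ellipticK p / L) p s := by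
  simp only [checkX, profX, jacobiCn_sub_ellipticK hp, neg_sq]
  ring

theorem checkY_eq {L p : ℝ} (hp : p ^ 2 < 1) (hL : L ≠ 0) (n : ℕ) (s : ℝ) :
    checkY L p n s = profY (2 * (n + 1) * ellipticK p / L) p s := by
  rw [checkY, profY, two_mul_div_frequency hp hL, jacobiCn_sub_ellipticK hp]
  ring

/-- The curves which are explicit elastica up to reflections satisfy `κ = -τ ν² y`. -/
theorem curvature_eq_of_eq_profile {l L : ℝ} {γ : ℝ → Plane} (h : IsAdmissible l L γ)
    {ν p τ σ : ℝ} (hp : p ^ 2 < 1) (hν : ν ≠ 0) (hτ : τ ^ 2 = 1) (hσ : σ ^ 2 = 1)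
    (hγ : ∀ t ∈ Icc (0 : ℝ) 1,
      γ t = !₂[τ * profX ν p (arcLength γ t), σ * profY ν p (arcLength γ t)]) :
    ∀ t ∈ Icc (0 : ℝ) 1, curvature γ t = -(τ * ν ^ 2) * γ t 1 := by
  have hu := uniqueDiffOn_unitInterval
  have hv0 : ∀ t ∈ Icc (0 : ℝ) 1, vel γ t 0 / ‖vel γ t‖ = τ * profXi ν p (arcLength γ t) := by
    intro t ht
    have h1 := ((hasDerivAt_profX hp (ν := ν) _).comp_hasDerivWithinAt t
      (h.hasDerivWithinAt_arcLength ht)).const_mul τ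
    have h2 := (hu t ht).eq_deriv _ (hasDerivWithinAt_curve_coord h.smooth ht 0)
      (h1.congr (fun t ht => by rw [hγ t ht]; rfl) (by rw [hγ t ht]; rfl))
    rw [h2, ← mul_assoc, mul_div_cancel_right₀ _ (h.speed_pos ht).ne']
  have hv1 : ∀ t ∈ Icc (0 : ℝ) 1, vel γ t 1 / ‖vel γ t‖ = σ * profEta ν p (arcLength γ t) := by
    intro t ht
    have h1 := ((hasDerivAt_profY hp hν _).comp_hasDerivWithinAt t
      (h.hasDerivWithinAt_arcLength ht)).const_mul σ
    have h2 := (hu t ht).eq_deriv _ (hasDerivWithinAt_curve_coord h.smooth ht 1)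
      (h1.congr (fun t ht => by rw [hγ t ht]; rfl) (by rw [hγ t ht]; rfl))
    rw [h2, ← mul_assoc, mul_div_cancel_right₀ _ (h.speed_pos ht).ne']
  intro t ht
  have hn := h.speed_pos ht
  have e0 := (hu t ht).eq_deriv _ (h.hasDerivWithinAt_tangent_zero ht)
    ((((hasDerivAt_profXi hp hν _).comp_hasDerivWithinAt t
      (h.hasDerivWithinAt_arcLength ht)).const_mul τ).congr hv0 (hv0 t ht))
  have e1 := (hu t ht).eq_deriv _ (h.hasDerivWithinAt_tangent_one ht)
    ((((hasDerivAt_profEta hp hν _).comp_hasDerivWithinAt t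
      (h.hasDerivWithinAt_arcLength ht)).const_mul σ).congr hv1 (hv1 t ht))
  have v0 := hv0 t ht
  have v1 := hv1 t ht
  rw [div_eq_iff hn.ne'] at v0 v1
  rw [v1] at e0
  rw [v0] at e1
  have hy : γ t 1 = σ * profY ν p (arcLength γ t) := by rw [hγ t ht]; rfl
  have hone := profXi_sq_add_profEta_sq (ν := ν) hp (arcLength γ t)
  rw [hy]
  set Ξ := profXi ν p (arcLength γ t)
  set H := profEta ν p (arcLength γ t)
  set Y := profY ν p (arcLength γ t)
  set n := ‖vel γ t‖
  refine mul_right_cancel₀ hn.ne' ?_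
  -- Pairing the Frenet equations with the normal gives `κ` the coefficient `τ²Ξ² + σ²H² = 1`.
  linear_combination (-(σ * H)) * e0 + (τ * Ξ) * e1 -
    (curvature γ t * n + σ * τ * ν ^ 2 * Y * n) * hone -
    curvature γ t * n * H ^ 2 * hσ - curvature γ t * n * Ξ ^ 2 * hτ

section

/-! ### Solving the equation `κ = -lam y` -/

/-- Uniqueness for the first order system satisfied by height and unit tangent of an elastica,
with an arbitrary speed function `w`. -/
theorem elastica_system_unique {w : ℝ → ℝ} (hw : ContinuousOn w (Icc 0 1)) (k : ℝ)
    {f g : ℝ → ℝ × ℝ × ℝ}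
    (hf : ∀ t ∈ Icc (0 : ℝ) 1, HasDerivWithinAt f
      (w t • ((f t).2.2, k * (f t).1 * (f t).2.2, -(k * (f t).1 * (f t).2.1))) (Icc 0 1) t)
    (hg : ∀ t ∈ Icc (0 : ℝ) 1, HasDerivWithinAt g
      (w t • ((g t).2.2, k * (g t).1 * (g t).2.2, -(k * (g t).1 * (g t).2.1))) (Icc 0 1) t)
    (h0 : f 0 = g 0) : EqOn f g (Icc 0 1) := by
  have hfc : ContinuousOn f (Icc 0 1) := fun t ht => (hf t ht).continuousWithinAt
  have hgc : ContinuousOn g (Icc 0 1) := fun t ht => (hg t ht).continuousWithinAt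
  obtain ⟨A, hA⟩ := isCompact_Icc.exists_bound_of_continuousOn hfc
  obtain ⟨B, hB⟩ := isCompact_Icc.exists_bound_of_continuousOn hgc
  obtain ⟨M, hM⟩ := isCompact_Icc.exists_bound_of_continuousOn hw
  set V : ℝ × ℝ × ℝ → ℝ × ℝ × ℝ := fun q => (q.2.2, k * q.1 * q.2.2, -(k * q.1 * q.2.1)) with hV
  have hVs : ContDiff ℝ 1 V := by fun_prop
  -- The field is quadratic, hence only locally Lipschitz; a ball containing both trajectories
  -- suffices.
  obtain ⟨K, hK⟩ := hVs.contDiffOn.exists_lipschitzOnWith one_ne_zero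
    (convex_closedBall (0 : ℝ × ℝ × ℝ) (max A B)) (isCompact_closedBall _ _)
  have hside : ∀ {u : ℝ → ℝ × ℝ × ℝ} {u' : ℝ × ℝ × ℝ} {t : ℝ}, t ∈ Ico (0 : ℝ) 1 →
      HasDerivWithinAt u u' (Icc 0 1) t → HasDerivWithinAt u u' (Ici t) t := fun ht h =>
    (h.mono (Icc_subset_Icc_left ht.1)).mono_of_mem_nhdsWithin (Icc_mem_nhdsGE ht.2)
  refine ODE_solution_unique_of_mem_Icc_right (v := fun t q => w t • V q)
    (s := fun _ => Metric.closedBall 0 (max A B)) (K := M.toNNReal * K) (fun t ht => ?_)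
    hfc (fun t ht => hside ht (hf t (Ico_subset_Icc_self ht))) (fun t ht => ?_)
    hgc (fun t ht => hside ht (hg t (Ico_subset_Icc_self ht))) (fun t ht => ?_) h0
  · refine LipschitzOnWith.of_dist_le_mul fun x hx y hy => ?_
    rw [dist_smul₀]
    have h1 := hK.dist_le_mul x hx y hy
    have h2 := hM t (Ico_subset_Icc_self ht)
    have h3 : (M.toNNReal : ℝ) = M := Real.coe_toNNReal _ ((norm_nonneg _).trans h2)
    rw [NNReal.coe_mul, h3, mul_assoc]
    exact mul_le_mul h2 h1 dist_nonneg ((norm_nonneg _).trans h2)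
  · exact mem_closedBall_zero_iff.2 ((hA t (Ico_subset_Icc_self ht)).trans (le_max_left _ _))
  · exact mem_closedBall_zero_iff.2 ((hB t (Ico_subset_Icc_self ht)).trans (le_max_right _ _))

variable {l L : ℝ} {γ : ℝ → Plane}

theorem IsAdmissible.tangent_sq (h : IsAdmissible l L γ) {t : ℝ} (ht : t ∈ Icc (0 : ℝ) 1) :
    (vel γ t 0 / ‖vel γ t‖) ^ 2 + (vel γ t 1 / ‖vel γ t‖) ^ 2 = 1 := by
  rw [div_pow, div_pow, ← add_div, ← plane_norm_sq]
  exact div_self (pow_pos (h.speed_pos ht) 2).ne'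

/-- A solution of `κ = -lam y` has `lam ≠ 0`. -/
theorem ne_zero_of_curvature_eq (h : IsAdmissible l L γ) (hl : 0 < l) (hlL : l < L) {lam : ℝ}
    (hκ : ∀ t ∈ Icc (0 : ℝ) 1, curvature γ t = -lam * γ t 1) : lam ≠ 0 := by
  rintro rfl
  have hm1 : (1 : ℝ) ∈ Icc (0 : ℝ) 1 := right_mem_Icc.2 zero_le_one
  have hconst : ∀ t ∈ Icc (0 : ℝ) 1, vel γ t 1 = vel γ 0 1 / ‖vel γ 0‖ * ‖vel γ t‖ := by
    intro t ht
    have := eq_of_hasDerivWithinAt_zero (f := fun t => vel γ t 1 / ‖vel γ t‖) (fun t ht => by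
      simpa [hκ t ht] using h.hasDerivWithinAt_tangent_one ht) ht
    rwa [div_eq_iff (h.speed_pos ht).ne'] at this
  have hint : vel γ 0 1 / ‖vel γ 0‖ * L = 0 := by
    have h1 := integral_eq_sub_of_hasDerivWithinAt
      (fun t ht => hasDerivWithinAt_curve_coord h.smooth ht 1)
      (smooth_coord (smooth_vel h.smooth) 1).continuousOn hm1
    rw [h.start, h.finish] at h1
    rw [← h.length_eq, length, arcLength, ← intervalIntegral.integral_const_mul]
    refine (intervalIntegral.integral_congr fun t ht => ?_).trans (h1.trans (by simp))
    rw [uIcc_of_le zero_le_one] at ht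
    exact (hconst t ht).symm
  have hz := (mul_eq_zero.1 hint).resolve_right (hl.trans hlL).ne'
  exact h.not_horizontal hl hlL fun t ht => by rw [hconst t ht, hz, zero_mul]

/-- Pinned curves with `κ = -τ ν² y` are explicit elastica up to reflections. -/
theorem exists_eq_profile (h : IsAdmissible l L γ) (hl : 0 < l) (hlL : l < L) {ν τ : ℝ}
    (hν : ν ≠ 0) (hτ : τ ^ 2 = 1)
    (hκ : ∀ t ∈ Icc (0 : ℝ) 1, curvature γ t = -(τ * ν ^ 2) * γ t 1) :
    ∃ p σ : ℝ, p ∈ Ioo (0 : ℝ) 1 ∧ (σ = 1 ∨ σ = -1) ∧ ∀ t ∈ Icc (0 : ℝ) 1,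
      γ t = !₂[τ * profX ν p (arcLength γ t), σ * profY ν p (arcLength γ t)] := by
  have hm0 : (0 : ℝ) ∈ Icc (0 : ℝ) 1 := left_mem_Icc.2 zero_le_one
  have hw := h.smooth_speed.continuousOn
  -- The factor `τ` in the second component makes the system the same for both signs.
  set f : ℝ → ℝ × ℝ × ℝ := fun t =>
    (γ t 1, τ * (vel γ t 0 / ‖vel γ t‖), vel γ t 1 / ‖vel γ t‖) with hf
  have hfd : ∀ t ∈ Icc (0 : ℝ) 1, HasDerivWithinAt f (‖vel γ t‖ • ((f t).2.2,
      ν ^ 2 * (f t).1 * (f t).2.2, -(ν ^ 2 * (f t).1 * (f t).2.1))) (Icc 0 1) t := by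
    intro t ht
    have hn := (h.speed_pos ht).ne'
    refine ((hasDerivWithinAt_curve_coord h.smooth ht 1).prodMk
      (((h.hasDerivWithinAt_tangent_zero ht).const_mul τ).prodMk
        (h.hasDerivWithinAt_tangent_one ht))).congr_deriv ?_
    simp only [hf, Prod.smul_mk, smul_eq_mul, Prod.mk.injEq, hκ t ht]
    refine ⟨by field_simp, ?_, by field_simp⟩
    field_simp
    linear_combination γ t 1 * vel γ t 1 * hτ
  have hone := h.tangent_sq hm0
  set ξ := τ * (vel γ 0 0 / ‖vel γ 0‖) with hξ
  set η := vel γ 0 1 / ‖vel γ 0‖ with hη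
  have hone' : ξ ^ 2 + η ^ 2 = 1 := by rw [hξ, mul_pow, hτ, one_mul]; exact hone
  have hy0 : γ 0 1 = 0 := by rw [h.start]; rfl
  have hf0 : f 0 = (0, ξ, η) := by simp only [hf, hy0, hξ, hη]
  -- Height zero with a horizontal tangent is an equilibrium of the system, so the curve would stay
  -- horizontal.
  have hη0 : η ≠ 0 := by
    intro hη0
    have hcst := elastica_system_unique hw (ν ^ 2) (g := fun _ => (0, ξ, 0)) hfd
      (fun t _ => (hasDerivWithinAt_const t _ _).congr_deriv (by ext <;> simp))
      (by rw [hf0, hη0])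
    refine h.not_horizontal hl hlL fun t ht => ?_
    have h2 : vel γ t 1 / ‖vel γ t‖ = 0 := congrArg (fun q : ℝ × ℝ × ℝ => q.2.2) (hcst ht)
    exact (div_eq_zero_iff.1 h2).resolve_right (h.speed_pos ht).ne'
  have hη2 : 0 < η ^ 2 := by positivity
  have hξlt : ξ ^ 2 < 1 := by linarith
  have hξ1 : -1 < ξ ∧ ξ < 1 := abs_lt.1 ((sq_lt_one_iff_abs_lt_one ξ).1 hξlt)
  -- Solves `1 - 2p² = ξ`, the initial horizontal tangent of the profile; `σ` below is the sign of
  -- the initial slope.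
  set p := √((1 - ξ) / 2) with hp
  have hp2 : p ^ 2 = (1 - ξ) / 2 := Real.sq_sqrt (by linarith [hξ1.2])
  have hp0 : 0 < p := Real.sqrt_pos.2 (by linarith [hξ1.2])
  have hp1 : p ^ 2 < 1 := by rw [hp2]; linarith [hξ1.1]
  obtain ⟨σ, hσ, hση⟩ : ∃ σ : ℝ, (σ = 1 ∨ σ = -1) ∧ η = σ * (2 * p * √(1 - p ^ 2)) := by
    have hsq : η ^ 2 = (2 * p * √(1 - p ^ 2)) ^ 2 := by
      rw [mul_pow, mul_pow, Real.sq_sqrt (show 0 ≤ 1 - p ^ 2 by linarith), hp2]; linarith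
    rcases sq_eq_sq_iff_eq_or_eq_neg.1 hsq with h1 | h1
    · exact ⟨1, .inl rfl, by rw [h1, one_mul]⟩
    · exact ⟨-1, .inr rfl, by rw [h1, neg_one_mul]⟩
  have hσ2 : σ ^ 2 = 1 := by rcases hσ with rfl | rfl <;> norm_num
  refine ⟨p, σ, ⟨hp0, by nlinarith⟩, hσ, ?_⟩
  set g : ℝ → ℝ × ℝ × ℝ := fun t => (σ * profY ν p (arcLength γ t), profXi ν p (arcLength γ t),
    σ * profEta ν p (arcLength γ t)) with hg
  have hgd : ∀ t ∈ Icc (0 : ℝ) 1, HasDerivWithinAt g (‖vel γ t‖ • ((g t).2.2,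
      ν ^ 2 * (g t).1 * (g t).2.2, -(ν ^ 2 * (g t).1 * (g t).2.1))) (Icc 0 1) t := by
    intro t ht
    have hs := h.hasDerivWithinAt_arcLength ht
    refine ((((hasDerivAt_profY hp1 hν _).comp_hasDerivWithinAt t hs).const_mul σ).prodMk
      (((hasDerivAt_profXi hp1 hν _).comp_hasDerivWithinAt t hs).prodMk
        (((hasDerivAt_profEta hp1 hν _).comp_hasDerivWithinAt t hs).const_mul σ))).congr_deriv ?_
    simp only [hg, Prod.smul_mk, smul_eq_mul, Prod.mk.injEq]
    refine ⟨by ring, ?_, by ring⟩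
    linear_combination (-(‖vel γ t‖ * ν ^ 2 * profY ν p (arcLength γ t) *
      profEta ν p (arcLength γ t))) * hσ2
  have hfg := elastica_system_unique hw (ν ^ 2) hfd hgd (by
    rw [hf0]
    simp only [hg, arcLength_zero, profY_zero hp1, profXi_zero hp1, profEta_zero hp1, mul_zero,
      Prod.mk.injEq, true_and]
    exact ⟨by rw [hp2]; ring, hση⟩)
  have hx : ∀ t ∈ Icc (0 : ℝ) 1, γ t 0 = τ * profX ν p (arcLength γ t) := by
    intro t ht
    have hder : ∀ t ∈ Icc (0 : ℝ) 1,
        HasDerivWithinAt (fun t => γ t 0 - τ * profX ν p (arcLength γ t)) 0 (Icc 0 1) t := by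
      intro t ht
      have hn := (h.speed_pos ht).ne'
      refine ((hasDerivWithinAt_curve_coord h.smooth ht 0).sub
        (((hasDerivAt_profX hp1 _).comp_hasDerivWithinAt t
          (h.hasDerivWithinAt_arcLength ht)).const_mul τ)).congr_deriv ?_
      have h2 : τ * (vel γ t 0 / ‖vel γ t‖) = profXi ν p (arcLength γ t) :=
        congrArg (fun q : ℝ × ℝ × ℝ => q.2.1) (hfg ht)
      rw [← h2]
      field_simp
      linear_combination (-vel γ t 0) * hτ
    have := eq_of_hasDerivWithinAt_zero hder ht
    simp only [arcLength_zero, h.start] at this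
    simp [profX] at this
    simp [profX]
    linarith
  intro t ht
  have hyt : γ t 1 = σ * profY ν p (arcLength γ t) :=
    congrArg (fun q : ℝ × ℝ × ℝ => q.1) (hfg ht)
  ext i
  fin_cases i
  · exact hx t ht
  · exact hyt

/-- The end point conditions quantize the frequency and determine the modulus. -/
theorem exists_frequency_eq (h : IsAdmissible l L γ) (hL : 0 < L) {ν τ p σ : ℝ} (hν : 0 < ν)
    (hp : p ∈ Ioo (0 : ℝ) 1) (hσ : σ ≠ 0)
    (hγ : ∀ t ∈ Icc (0 : ℝ) 1,
      γ t = !₂[τ * profX ν p (arcLength γ t), σ * profY ν p (arcLength γ t)]) :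
    ∃ n : ℕ, ν = 2 * (n + 1) * ellipticK p / L ∧
      l / L = τ * (2 * (ellipticE p / ellipticK p) - 1) := by
  have hp1 : p ^ 2 < 1 := by nlinarith [hp.1, hp.2]
  have hK := ellipticK_pos hp1
  have hend := hγ 1 (right_mem_Icc.2 zero_le_one)
  rw [h.arcLength_one, h.finish] at hend
  have hx : l = τ * profX ν p L := congrArg (fun v : Plane => v 0) hend
  have hy : 0 = σ * profY ν p L := congrArg (fun v : Plane => v 1) hend
  have hcn : jacobiCn (ν * L + ellipticK p) p = 0 := by
    have h1 := (mul_eq_zero.1 hy.symm).resolve_left hσ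
    rw [profY] at h1
    refine (mul_eq_zero.1 h1).resolve_left (neg_ne_zero.2 ?_)
    have := hp.1
    positivity
  obtain ⟨n, hn, ham⟩ := exists_eq_of_jacobiCn_eq_zero hp1 (mul_pos hν hL) hcn
  refine ⟨n, by rw [← hn]; field_simp, ?_⟩
  -- At `s = L` the incomplete integral is `(2n+3)E` and the argument of `am` is `(2n+3)K`, so the
  -- abscissa is `2(n+1)(2E - K)/ν`.
  rw [hx, profX_eq hp1 hν.ne', profAm, ham, ellipticEInc_pi_div_two_add]
  have hνL : ν = 2 * (n + 1) * ellipticK p / L := by rw [← hn]; field_simp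
  rw [hn, hνL]
  have : (n + 1 : ℝ) ≠ 0 := by positivity
  push_cast
  field_simp
  ring

theorem hatCurve_eq {p : ℝ} (hp : p ^ 2 < 1) (hL : L ≠ 0) (n : ℕ) (σ s : ℝ) :
    hatCurve L p n σ s = !₂[1 * profX (2 * (n + 1) * ellipticK p / L) p s,
      σ * profY (2 * (n + 1) * ellipticK p / L) p s] := by
  rw [hatCurve, hatX_eq, hatY_eq hp hL, one_mul]

theorem checkCurve_eq {p : ℝ} (hp : p ^ 2 < 1) (hL : L ≠ 0) (n : ℕ) (σ s : ℝ) :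
    checkCurve L p n σ s = !₂[-1 * profX (2 * (n + 1) * ellipticK p / L) p s,
      σ * profY (2 * (n + 1) * ellipticK p / L) p s] := by
  rw [checkCurve, checkX_eq hp, checkY_eq hp hL, neg_one_mul]

end

end PinnedElastica

theorem theorem1p1 (l L : ℝ) (hl : 0 < l) (hlL : l < L) :
    (∃! p : ℝ, PinnedElastica.IsHatModulus l L p) ∧
    (∃! p : ℝ, PinnedElastica.IsCheckModulus l L p) ∧
    ∀ p q : ℝ, PinnedElastica.IsHatModulus l L p → PinnedElastica.IsCheckModulus l L q →
      {γ : ℝ → PinnedElastica.Plane | PinnedElastica.IsCriticalPoint l L γ} =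
      {γ : ℝ → PinnedElastica.Plane | PinnedElastica.IsAdmissible l L γ ∧ ∃ n : ℕ,
        EqOn (PinnedElastica.arcLengthReparam γ) (PinnedElastica.hatCurve L p n 1) (Icc 0 L) ∨
        EqOn (PinnedElastica.arcLengthReparam γ) (PinnedElastica.hatCurve L p n (-1)) (Icc 0 L) ∨
        EqOn (PinnedElastica.arcLengthReparam γ) (PinnedElastica.checkCurve L q n 1) (Icc 0 L) ∨
        EqOn (PinnedElastica.arcLengthReparam γ)
          (PinnedElastica.checkCurve L q n (-1)) (Icc 0 L)} := by
  have hL : 0 < L := hl.trans hlL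
  have huH := PinnedElastica.existsUnique_isHatModulus hl hlL
  have huC := PinnedElastica.existsUnique_isCheckModulus hl hlL
  refine ⟨huH, huC, fun p q hp hq => ?_⟩
  have hp1 : p ^ 2 < 1 := by nlinarith [hp.1.1, hp.1.2]
  have hq1 : q ^ 2 < 1 := by nlinarith [hq.1.1, hq.1.2]
  ext γ
  simp only [mem_ofPred_eq]
  constructor
  · intro hcrit
    obtain ⟨lam, hκ⟩ := PinnedElastica.exists_curvature_eq hcrit hl hlL
    have h := hcrit.1
    refine ⟨h, ?_⟩
    simp only [h.eqOn_arcLengthReparam_iff, PinnedElastica.hatCurve_eq hp1 hL.ne',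
      PinnedElastica.checkCurve_eq hq1 hL.ne']
    have hlam := PinnedElastica.ne_zero_of_curvature_eq h hl hlL hκ
    have hν : 0 < √|lam| := Real.sqrt_pos.2 (abs_pos.2 hlam)
    have hν2 : √|lam| ^ 2 = |lam| := Real.sq_sqrt (abs_nonneg _)
    -- The sign of `lam` is `τ`: negative `lam` reflects the horizontal coordinate and yields the
    -- check modulus, positive `lam` the hat modulus.
    rcases hlam.lt_or_gt with hneg | hpos
    · have hlameq : lam = -1 * √|lam| ^ 2 := by rw [hν2, abs_of_neg hneg]; ring
      obtain ⟨q', σ, hq', hσ, hγ⟩ := PinnedElastica.exists_eq_profile h hl hlL (τ := -1) hν.ne'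
        (by norm_num) (by rw [← hlameq]; exact hκ)
      obtain ⟨n, hn, hmod⟩ := PinnedElastica.exists_frequency_eq h hL hν hq'
        (by rcases hσ with rfl | rfl <;> norm_num) hγ
      obtain rfl : q' = q := huC.unique ⟨hq', by linarith⟩ hq
      rw [hn] at hγ
      rcases hσ with rfl | rfl
      · exact ⟨n, .inr (.inr (.inl hγ))⟩
      · exact ⟨n, .inr (.inr (.inr hγ))⟩
    · have hlameq : lam = 1 * √|lam| ^ 2 := by rw [hν2, abs_of_pos hpos]; ring
      obtain ⟨p', σ, hp', hσ, hγ⟩ := PinnedElastica.exists_eq_profile h hl hlL (τ := 1) hν.ne'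
        (by norm_num) (by rw [← hlameq]; exact hκ)
      obtain ⟨n, hn, hmod⟩ := PinnedElastica.exists_frequency_eq h hL hν hp'
        (by rcases hσ with rfl | rfl <;> norm_num) hγ
      obtain rfl : p' = p := huH.unique ⟨hp', by linarith⟩ hp
      rw [hn] at hγ
      rcases hσ with rfl | rfl
      · exact ⟨n, .inl hγ⟩
      · exact ⟨n, .inr (.inl hγ)⟩
  · rintro ⟨h, n, hn⟩
    simp only [h.eqOn_arcLengthReparam_iff, PinnedElastica.hatCurve_eq hp1 hL.ne',
      PinnedElastica.checkCurve_eq hq1 hL.ne'] at hn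
    have hfreq : ∀ {r : ℝ}, r ^ 2 < 1 → 2 * (n + 1) * PinnedElastica.ellipticK r / L ≠ 0 :=
      fun hr => by
        have := PinnedElastica.ellipticK_pos hr
        positivity
    have key : ∀ {r τ σ : ℝ}, r ^ 2 < 1 → τ ^ 2 = 1 → σ ^ 2 = 1 → (∀ t ∈ Icc (0 : ℝ) 1,
        γ t = !₂[τ * PinnedElastica.profX (2 * (n + 1) * PinnedElastica.ellipticK r / L) r
          (PinnedElastica.arcLength γ t),
          σ * PinnedElastica.profY (2 * (n + 1) * PinnedElastica.ellipticK r / L) r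
          (PinnedElastica.arcLength γ t)]) → PinnedElastica.IsCriticalPoint l L γ :=
      fun hr hτ hσ hγ => PinnedElastica.isCriticalPoint_of_curvature_eq h
        (PinnedElastica.curvature_eq_of_eq_profile h hr (hfreq hr) hτ hσ hγ)
    rcases hn with hn | hn | hn | hn
    · exact key hp1 (by norm_num) (by norm_num) hn
    · exact key hp1 (by norm_num) (by norm_num) hn
    · exact key hq1 (by norm_num) (by norm_num) hn
    · exact key hq1 (by norm_num) (by norm_num) hn
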